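/- Let $\mathcal X$ be a Polish space with a Borel probability measure $\mu$, let $\|\cdot\|$ be the norm of $L^2_\mu$, let $m\ge 1$, and let $V_m=\mathrm{span}\{\varphi_1,\dots,\varphi_m\}$ with $\varphi_1,\dots,\varphi_m:\mathcal X\to\mathbb R$ orthonormal in $L^2_\mu$. Put $w_m=\frac1m\sum_{j=1}^m\varphi_j^2$. Let $h$ be a strictly positive probability density with respect to $\mu$, and let $H$ be a normed space of functions on $\mathcal X$ such that, for a constant $C_H\ge 0$ and all $u\in H$, $$\|u\|\le C_H\|u\|_H\qquad\text{and}\qquad \operatorname*{ess\,sup}_{x\in\mathcal X}\,h(x)^{-1/2}|u(x)|\le\|u\|_H .$$ Let $0\le\alpha<1$, $w=\alpha w_m+(1-\alpha)h$ and $\nu=w\mu$. For points $\mathbf x=(x_1,\dots,x_n)$ let $\Phi^w(\mathbf x)$ be the $n\times m$ matrix with entries $w(x_i)^{-1/2}\varphi_j(x_i)$ and $\mathbf G^w(\mathbf x)=\frac1n\Phi^w(\mathbf x)^T\Phi^w(\mathbf x)$. For $\bar n\ge m$ let $\gamma^\nu_{\bar n}$ be the volume sampling distribution on $\mathcal X^{\bar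 n}$, $$d\gamma^\nu_{\bar n}(\mathbf x)=\frac{(\bar n-m)!}{\bar n!}\det\big(\Phi^w(\mathbf x)^T\Phi^w(\mathbf x)\big)\,d\nu^{\otimes\bar n}(\mathbf x).$$ Let $r\ge1$, $n=\bar n r$, let $\mathbf x=(x_1,\dots,x_n)$ be drawn from $(\gamma^\nu_{\bar n})^{\otimes r}$, let $f\in H$, and let $\hat f_m$ be a weighted least-squares projection of $f$, i.e. a minimizer of $\frac1n\sum_{i=1}^n w(x_i)^{-1}(f(x_i)-g(x_i))^2$ over $g\in V_m$. Let $0<\delta<1$, $c_\delta=\delta+(1-\delta)\log(1-\delta)$ and $S_\delta=\{\lambda_{\min}(\mathbf G^w(\mathbf x))\ge1-\delta\}$. Below, $\|u\|_H=\infty$ if $u\notin H$. (i) With probability at least $\mathbb P(S_\delta)$, $$\|f-\hat f_m\|\le\Big(C_H+(1-\delta)^{-1/2}(1-\alpha)^{-1/2}\Big)\inf_{g\in V_m}\|f-g\|_H .$$ (ii) If $\alpha>0$, $\bar n>m$ and $\bar n\ge m+c_\delta^{-1}\alpha^{-1}m\log(nm^2)$, then $\|f-\hat f_m\|^2$ is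 integrable and $$\mathbb E\big(\|f-\hat f_m\|^2\big)\le\Big(2C_H^2+2(1-\alpha)^{-1}r\big(1+(1-\tfrac m{\bar n})^{-1}(1-\delta)^{-1}\big)\Big)\inf_{g\in V_m}\|f-g\|_H^2 .$$ -/

import Mathlib

open MeasureTheory
open scoped ENNReal

namespace WLS

noncomputable section

/-- The `L²_μ` norm `(∫ |g|² dμ)^{1/2}` of a square-integrable function. -/
def l2norm {X : Type*} [MeasurableSpace X] (μ : Measure X) (g : X → ℝ) : ℝ :=
  (eLpNorm g 2 μ).toReal

/-- `φ₁, …, φ_m` are measurable, square-integrable and orthonormal in `L²_μ`. -/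
structure IsONSystem {X : Type*} [MeasurableSpace X] (μ : Measure X) {m : ℕ}
    (φ : Fin m → X → ℝ) : Prop where
  measurable : ∀ j, Measurable (φ j)
  memLp : ∀ j, MemLp (φ j) 2 μ
  orthonormal : ∀ i j, ∫ x, φ i x * φ j x ∂μ = if i = j then 1 else 0

/-- The approximation space `V_m`, spanned by `φ₁, …, φ_m`. -/
def approxSpace {X : Type*} {m : ℕ} (φ : Fin m → X → ℝ) : Submodule ℝ (X → ℝ) :=
  Submodule.span ℝ (Set.range φ)

/-- The inverse Christoffel function `w_m(x) = (1/m) ∑ φ_j(x)²`. -/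
def christoffelWeight {X : Type*} {m : ℕ} (φ : Fin m → X → ℝ) (x : X) : ℝ :=
  (1 / (m : ℝ)) * ∑ j, φ j x ^ 2

/-- The mixture density `w = α w_m + (1 - α) h`. -/
def mixtureWeight {X : Type*} {m : ℕ} (φ : Fin m → X → ℝ) (h : X → ℝ) (α : ℝ) (x : X) : ℝ :=
  α * christoffelWeight φ x + (1 - α) * h x

/-- The measure `ν = w μ`. -/
def weightedMeasure {X : Type*} [MeasurableSpace X] (μ : Measure X) (w : X → ℝ) : Measure X :=
  μ.withDensity (fun x => ENNReal.ofReal (w x))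

/-- The matrix `Φ^w(x)` whose `i`-th row is `w(x_i)^{-1/2} (φ₁(x_i), …, φ_m(x_i))`. -/
def featureMatrix {X ι : Type*} {m : ℕ} (φ : Fin m → X → ℝ) (w : X → ℝ) (x : ι → X) :
    Matrix ι (Fin m) ℝ :=
  Matrix.of fun i j => (√(w (x i)))⁻¹ * φ j (x i)

/-- The volume sampling distribution `γ_n^ν` on `X^n`, `ν = w μ`: it has the density
`((n - m)! / n!) det (Φ^w(x)ᵀ Φ^w(x))` with respect to `ν^{⊗ n}` (used for `n ≥ m`). -/
def volumeSampling {X : Type*} [MeasurableSpace X] (μ : Measure X) {m : ℕ}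
    (φ : Fin m → X → ℝ) (w : X → ℝ) (n : ℕ) : Measure (Fin n → X) :=
  (Measure.pi fun _ : Fin n => weightedMeasure μ w).withDensity fun x =>
    ENNReal.ofReal
      (((n - m).factorial : ℝ) / (n.factorial : ℝ) * ((featureMatrix φ w x).transpose * featureMatrix φ w x).det)

/-- The law `(γ_{n̄}^ν)^{⊗ r}` of `r` independent samples from `γ_{n̄}^ν`. -/
def repeatedVolumeSampling {X : Type*} [MeasurableSpace X] (μ : Measure X) {m : ℕ}
    (φ : Fin m → X → ℝ) (w : X → ℝ) (nbar r : ℕ) : Measure (Fin r → Fin nbar → X) :=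
  Measure.pi fun _ : Fin r => volumeSampling μ φ w nbar

/-- The empirical Gram matrix `G^w(x) = (1/n) ∑ w(x_i)⁻¹ φ(x_i) φ(x_i)ᵀ`
of a family `x` of `n = card ι` points. -/
def gram {X ι : Type*} [Fintype ι] {m : ℕ} (φ : Fin m → X → ℝ) (w : X → ℝ) (x : ι → X) :
    Matrix (Fin m) (Fin m) ℝ :=
  Matrix.of fun j k =>
    (1 / (Fintype.card ι : ℝ)) * ∑ i, (w (x i))⁻¹ * (φ j (x i) * φ k (x i))

/-- The smallest eigenvalue of a (symmetric) real matrix. -/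
def lambdaMin {m : ℕ} (A : Matrix (Fin m) (Fin m) ℝ) : ℝ :=
  sInf (spectrum ℝ A)

/-- `p` is a weighted least-squares projection of `f` on `V_m` for the points `x`: it minimizes
`(1/n) ∑ w(x_i)⁻¹ (f(x_i) - g(x_i))²` over `g ∈ V_m`. -/
def IsLeastSquares {X ι : Type*} [Fintype ι] {m : ℕ} (φ : Fin m → X → ℝ) (w : X → ℝ)
    (f : X → ℝ) (x : ι → X) (p : X → ℝ) : Prop :=
  p ∈ approxSpace φ ∧
    IsMinOn
      (fun g : X → ℝ =>
        (1 / (Fintype.card ι : ℝ)) * ∑ i, (w (x i))⁻¹ * (f (x i) - g (x i)) ^ 2)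
      (approxSpace φ : Set (X → ℝ)) p

/-- `c_δ = δ + (1 - δ) log (1 - δ)`. -/
def cδ (δ : ℝ) : ℝ := δ + (1 - δ) * Real.log (1 - δ)

/-- `h` is a strictly positive probability density with respect to `μ`. -/
structure IsPosDensity {X : Type*} [MeasurableSpace X] (μ : Measure X) (h : X → ℝ) : Prop where
  measurable : Measurable h
  pos : ∀ x, 0 < h x
  lintegral_eq_one : ∫⁻ x, ENNReal.ofReal (h x) ∂μ = 1

/-- The space `H` of functions on `X` with norm `N` embeds continuously in `L²_μ`, with
constant `C`, and in the weighted space `L^∞` with weight `h^{-1/2}`, with constant one.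
A seminorm is allowed for `N`, so that `H` may be a space such as `L^∞_μ` whose elements are
identified when they agree almost everywhere. -/
structure Embeds {X : Type*} [MeasurableSpace X] (μ : Measure X) (h : X → ℝ)
    (H : Submodule ℝ (X → ℝ)) (N : Seminorm ℝ H) (C : ℝ) : Prop where
  memLp : ∀ u : H, MemLp (u : X → ℝ) 2 μ
  l2_le : ∀ u : H, l2norm μ (u : X → ℝ) ≤ C * N u
  linfty_le : ∀ u : H,
    eLpNorm (fun x => (√(h x))⁻¹ * |(u : X → ℝ) x|) ∞ μ ≤ ENNReal.ofReal (N u)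

/-- `inf_{g ∈ V_m} ‖f - g‖_H`, where `‖u‖_H = ∞` for `u ∉ H`: the infimum is taken over the
`g ∈ V_m` with `f - g ∈ H`; for `f ∈ H` there is at least one, `g = 0`. -/
def bestError {X : Type*} {m : ℕ} (φ : Fin m → X → ℝ) (H : Submodule ℝ (X → ℝ))
    (N : Seminorm ℝ H) (f : X → ℝ) : ℝ :=
  sInf {t : ℝ | ∃ g ∈ approxSpace φ, ∃ hg : f - g ∈ H, t = N ⟨f - g, hg⟩}

end

end WLS

/-! Let g in V_m have coefficients b, let c be those of the projection, and put v = w^{-1/2} φ. By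
orthonormality the L² distance from g to the projection is |c - b|. Projecting onto V_m does not
increase the empirical norm, and w ≥ (1-α)h, so the sum of (v(x_i)·(c-b))² over the sample is almost
surely at most n (1-α)⁻¹ ‖f-g‖_H². It remains to return from this sum to |c-b|². On S_δ the smallest
eigenvalue of the Gram matrix does so, which gives (i).

For (ii) an inverse smallest eigenvalue has to be controlled in expectation. One block of n̄ points
is enough: dropping the others only decreases the sum, and this is where the factor r comes from. By
Cauchy–Binet (`factorial_mul_det_transpose_mul_self`) the density of a block is an average, over the
injections selecting m of its points, of det(V)²/m!, where V has the selected v(x_i) as rows. Under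
each term the remaining n̄-m points are i.i.d. from ν and independent of the selected ones. Let S be
the sum of v vᵀ over the remaining points and let t > 0. If a·Sa ≥ t|a|², these points control a at
the price 1/t. Otherwise e^{θt} tr e^{-θS} ≥ 1, and the selected points take over through adj(V) V =
det(V) I, which gives det(V)²|a|² ≤ ‖adj V‖_F² |Va|². The weight det(V)² is exactly the one supplied
by the density, so no small determinant is ever inverted (`det_sq_mul_le_selectionBound`).

The expectations are then explicit: det(V)² has mean m!, ‖adj V‖_F² has mean m·m!, and tr e^{-θS} is
bounded by the matrix Chernoff argument, which rests on Golden–Thompson and on |v|² ≤ m/α. With t =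
(1-δ)(n̄-m) and the optimal θ, the condition on n̄ makes the second contribution at most 1/n̄
(`chernoff_tail_le`), so the mean price is at most 1/t + 1/n̄. -/

namespace WLS

open Matrix Filter Topology

/-! ### Lie–Trotter formula and the Golden–Thompson inequality. -/

section GoldenThompson

theorem norm_exp_le_exp_norm {𝔸 : Type*} [NormedRing 𝔸] [NormedAlgebra ℝ 𝔸] [CompleteSpace 𝔸]
    [NormOneClass 𝔸] (a : 𝔸) : ‖NormedSpace.exp a‖ ≤ Real.exp ‖a‖ := by
  rw [NormedSpace.exp_eq_tsum ℝ, Real.exp_eq_exp_ℝ, NormedSpace.exp_eq_tsum ℝ]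
  have h := NormedSpace.norm_expSeries_summable' (𝕂 := ℝ) a
  refine (norm_tsum_le_tsum_norm h).trans ?_
  refine h.tsum_le_tsum (fun n => ?_) (NormedSpace.expSeries_summable' (𝕂 := ℝ) ‖a‖)
  rw [norm_smul, smul_eq_mul, Real.norm_of_nonneg (by positivity)]
  gcongr
  exact norm_pow_le a n

theorem norm_pow_sub_pow_le {𝔸 : Type*} [NormedRing 𝔸] [NormOneClass 𝔸] {x y : 𝔸} {R : ℝ}
    (hR : 0 ≤ R) (hx : ‖x‖ ≤ R) (hy : ‖y‖ ≤ R) (n : ℕ) :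
    ‖x ^ (n + 1) - y ^ (n + 1)‖ ≤ (n + 1) * R ^ n * ‖x - y‖ := by
  induction n with
  | zero => simp
  | succ n ih =>
    have e : x ^ (n + 1 + 1) - y ^ (n + 1 + 1)
        = x * (x ^ (n + 1) - y ^ (n + 1)) + (x - y) * y ^ (n + 1) := by
      rw [pow_succ' x (n + 1), pow_succ' y (n + 1)]; noncomm_ring
    rw [e]
    calc _ ≤ ‖x‖ * ‖x ^ (n + 1) - y ^ (n + 1)‖ + ‖x - y‖ * ‖y‖ ^ (n + 1) :=
          (norm_add_le _ _).trans (add_le_add (norm_mul_le _ _)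
            ((norm_mul_le _ _).trans (by gcongr; exact norm_pow_le _ _)))
      _ ≤ R * ((n + 1) * R ^ n * ‖x - y‖) + ‖x - y‖ * R ^ (n + 1) := by gcongr
      _ = _ := by push_cast; ring

/-- The Lie–Trotter product formula along the powers of two. -/
theorem tendsto_exp_mul_exp_pow {𝔸 : Type*} [NormedRing 𝔸] [NormedAlgebra ℝ 𝔸] [CompleteSpace 𝔸]
    [NormOneClass 𝔸] (a b : 𝔸) :
    Tendsto (fun k : ℕ => (NormedSpace.exp (((2 : ℝ) ^ k)⁻¹ • a) *
      NormedSpace.exp (((2 : ℝ) ^ k)⁻¹ • b)) ^ (2 ^ k)) atTop (𝓝 (NormedSpace.exp (a + b))) := by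
  -- The two sides agree to first order at t = 0, so their difference is o(t). Taking the power 2^k
  -- = 1/t multiplies it by at most e^{‖a‖+‖b‖}/t, and the limit is still zero.
  have hd : HasDerivAt (fun t : ℝ => NormedSpace.exp (t • a) * NormedSpace.exp (t • b)
      - NormedSpace.exp (t • (a + b))) 0 0 := by
    have h := ((hasDerivAt_exp_smul_const (𝕂 := ℝ) a 0).mul
      (hasDerivAt_exp_smul_const (𝕂 := ℝ) b 0)).sub (hasDerivAt_exp_smul_const (𝕂 := ℝ) (a + b) 0)
    exact h.congr_deriv (by simp only [zero_smul, NormedSpace.exp_zero, one_mul, mul_one, sub_self])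
  have ht : Tendsto (fun k : ℕ => ((2 : ℝ) ^ k)⁻¹) atTop (𝓝[>] 0) := by
    rw [tendsto_nhdsWithin_iff]
    refine ⟨(tendsto_pow_atTop_atTop_of_one_lt (by norm_num : (1 : ℝ) < 2)).inv_tendsto_atTop, ?_⟩
    exact Eventually.of_forall fun k => by simp
  have hs := (hd.tendsto_slope_zero_right.comp ht).norm
  simp only [Function.comp_def, zero_add, zero_smul, NormedSpace.exp_zero, mul_one, sub_self,
    sub_zero, inv_inv, norm_zero] at hs
  rw [tendsto_iff_norm_sub_tendsto_zero]
  have hs2 := hs.const_mul (Real.exp (‖a‖ + ‖b‖))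
  rw [mul_zero] at hs2
  refine squeeze_zero (fun _ => norm_nonneg _) (fun k => ?_) hs2
  set t : ℝ := ((2 : ℝ) ^ k)⁻¹ with htdef
  have ht0 : 0 < t := by positivity
  obtain ⟨n, hn⟩ : ∃ n, 2 ^ k = n + 1 := ⟨2 ^ k - 1, (Nat.sub_add_cancel Nat.one_le_two_pow).symm⟩
  have hn' : (2 : ℝ) ^ k = n + 1 := by exact_mod_cast hn
  have hab : NormedSpace.exp (a + b) = NormedSpace.exp (t • (a + b)) ^ (2 ^ k) := by
    let := NormedAlgebra.restrictScalars ℚ ℝ 𝔸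
    rw [← NormedSpace.exp_nsmul]
    congr 1
    rw [← Nat.cast_smul_eq_nsmul ℝ, smul_smul, htdef]
    push_cast
    rw [mul_inv_cancel₀ (by positivity), one_smul]
  have hx : ‖NormedSpace.exp (t • a) * NormedSpace.exp (t • b)‖ ≤ Real.exp (t * (‖a‖ + ‖b‖)) := by
    refine (norm_mul_le _ _).trans ?_
    rw [mul_add, Real.exp_add]
    gcongr
    · exact (norm_exp_le_exp_norm _).trans (by rw [norm_smul, Real.norm_of_nonneg ht0.le])
    · exact (norm_exp_le_exp_norm _).trans (by rw [norm_smul, Real.norm_of_nonneg ht0.le])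
  have hy : ‖NormedSpace.exp (t • (a + b))‖ ≤ Real.exp (t * (‖a‖ + ‖b‖)) := by
    refine (norm_exp_le_exp_norm _).trans ?_
    rw [norm_smul, Real.norm_of_nonneg ht0.le]
    gcongr
    exact norm_add_le _ _
  rw [hab, hn]
  refine (norm_pow_sub_pow_le (Real.exp_pos _).le hx hy n).trans ?_
  have hR : Real.exp (t * (‖a‖ + ‖b‖)) ^ n ≤ Real.exp (‖a‖ + ‖b‖) := by
    rw [← Real.exp_nat_mul]
    gcongr
    have : (n : ℝ) * t ≤ 1 := by
      rw [htdef, hn', ← div_eq_mul_inv, div_le_one (by positivity)]; linarith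
    calc (n : ℝ) * (t * (‖a‖ + ‖b‖)) = (n * t) * (‖a‖ + ‖b‖) := by ring
      _ ≤ 1 * (‖a‖ + ‖b‖) := by gcongr
      _ = _ := one_mul _
  rw [norm_smul, hn', Real.norm_of_nonneg (by positivity)]
  calc _ = Real.exp (t * (‖a‖ + ‖b‖)) ^ n * ((n + 1) *
        ‖NormedSpace.exp (t • a) * NormedSpace.exp (t • b) - NormedSpace.exp (t • (a + b))‖) := by
        ring
    _ ≤ _ := by gcongr

variable {m : ℕ}

theorem trace_mul_le (P Q : Matrix (Fin m) (Fin m) ℝ) :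
    (P * Q).trace ≤ ((P * Pᵀ).trace + (Qᵀ * Q).trace) / 2 := by
  have h : 0 ≤ ((P - Qᵀ) * (P - Qᵀ)ᵀ).trace := by
    simp only [Matrix.trace, Matrix.diag_apply, Matrix.mul_apply, Matrix.transpose_apply]
    exact Finset.sum_nonneg fun i _ => Finset.sum_nonneg fun j _ => mul_self_nonneg _
  have e : (Qᵀ * Pᵀ).trace = (P * Q).trace := by
    rw [← Matrix.transpose_mul, Matrix.trace_transpose]
  simp only [Matrix.transpose_sub, Matrix.transpose_transpose, Matrix.sub_mul, Matrix.mul_sub,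
    Matrix.trace_sub, e] at h
  linarith

theorem trace_mul_pow_comm (P Q : Matrix (Fin m) (Fin m) ℝ) (n : ℕ) :
    ((P * Q) ^ n).trace = ((Q * P) ^ n).trace := by
  cases n with
  | zero => simp
  | succ n =>
    have h : (P * Q) ^ n * P = P * (Q * P) ^ n := by
      induction n with
      | zero => simp
      | succ n ih => rw [pow_succ', mul_assoc, ih, pow_succ']; simp only [mul_assoc]
    rw [pow_succ, ← mul_assoc, h, Matrix.trace_mul_comm, ← mul_assoc, pow_succ']

/-- The two families feed each other. Applying the first at level k to M² or to AB produces, after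
cyclic rotation, a product of two symmetric matrices, which the second handles at level k. For M²,
`trace_mul_le` (the inequality 2⟨P,Q⟩ ≤ |P|² + |Q|² for the Frobenius product) then merges the two
powers. -/
theorem trace_pow_two_pow_aux (k : ℕ) :
    (∀ M : Matrix (Fin m) (Fin m) ℝ, (M ^ 2 ^ (k + 1)).trace ≤ ((M * Mᵀ) ^ 2 ^ k).trace) ∧
    (∀ A B : Matrix (Fin m) (Fin m) ℝ, Aᵀ = A → Bᵀ = B →
      ((A * B) ^ 2 ^ k).trace ≤ (A ^ 2 ^ k * B ^ 2 ^ k).trace) := by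
  induction k with
  | zero =>
    refine ⟨fun M => ?_, fun A B _ _ => by simp⟩
    have h := trace_mul_le M M
    rw [Matrix.trace_mul_comm Mᵀ M] at h
    simp only [zero_add, pow_one, pow_two, pow_zero]
    linarith
  | succ k ih =>
    obtain ⟨ih1, ih2⟩ := ih
    refine ⟨fun M => ?_, fun A B hA hB => ?_⟩
    · have e1 : M ^ 2 ^ (k + 1 + 1) = (M * M) ^ 2 ^ (k + 1) := by
        rw [← pow_two, ← pow_mul]; congr 1; ring
      have e2 : ((M * M * (M * M)ᵀ) ^ 2 ^ k).trace
          = ((Mᵀ * M * (M * Mᵀ)) ^ 2 ^ k).trace := by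
        rw [Matrix.transpose_mul, show M * M * (Mᵀ * Mᵀ) = (M * (M * Mᵀ)) * Mᵀ by
          simp only [mul_assoc], trace_mul_pow_comm]
        simp only [mul_assoc]
      have h1 := ih1 (M * M)
      have h2 := ih2 (Mᵀ * M) (M * Mᵀ) (by simp) (by simp)
      have h3 := trace_mul_le ((Mᵀ * M) ^ 2 ^ k) ((M * Mᵀ) ^ 2 ^ k)
      have e3 : ((Mᵀ * M) ^ 2 ^ k * ((Mᵀ * M) ^ 2 ^ k)ᵀ).trace
          = ((M * Mᵀ) ^ 2 ^ (k + 1)).trace := by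
        rw [Matrix.transpose_pow, Matrix.transpose_mul, Matrix.transpose_transpose, ← pow_add,
          trace_mul_pow_comm]
        congr 2; ring
      have e4 : (((M * Mᵀ) ^ 2 ^ k)ᵀ * (M * Mᵀ) ^ 2 ^ k).trace
          = ((M * Mᵀ) ^ 2 ^ (k + 1)).trace := by
        rw [Matrix.transpose_pow, Matrix.transpose_mul, Matrix.transpose_transpose, ← pow_add]
        congr 2; ring
      rw [e1]
      linarith
    · have h1 := ih1 (A * B)
      have h2 := ih2 (A * A) (B * B) (by simp [hA]) (by simp [hB])
      have e1 : ((A * B * (A * B)ᵀ) ^ 2 ^ k).trace = ((A * A * (B * B)) ^ 2 ^ k).trace := by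
        rw [Matrix.transpose_mul, hA, hB, show A * B * (B * A) = (A * (B * B)) * A by
          simp only [mul_assoc], trace_mul_pow_comm]
        simp only [mul_assoc]
      have e2 : (A * A) ^ 2 ^ k * (B * B) ^ 2 ^ k = A ^ 2 ^ (k + 1) * B ^ 2 ^ (k + 1) := by
        rw [← pow_two, ← pow_two, ← pow_mul, ← pow_mul, show 2 * 2 ^ k = 2 ^ (k + 1) by ring]
      rw [← e2]
      linarith

theorem exp_smul_pow_two_pow (A : Matrix (Fin m) (Fin m) ℝ) (k : ℕ) :
    NormedSpace.exp (((2 : ℝ) ^ k)⁻¹ • A) ^ 2 ^ k = NormedSpace.exp A := by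
  rw [← Matrix.exp_nsmul, ← Nat.cast_smul_eq_nsmul ℝ, smul_smul]
  push_cast
  rw [mul_inv_cancel₀ (by positivity), one_smul]

/-- The Golden–Thompson inequality for real symmetric matrices. -/
theorem golden_thompson [NeZero m] {A B : Matrix (Fin m) (Fin m) ℝ} (hA : Aᵀ = A) (hB : Bᵀ = B) :
    (NormedSpace.exp (A + B)).trace ≤ (NormedSpace.exp A * NormedSpace.exp B).trace := by
  let := Matrix.linftyOpNormedRing (n := Fin m) (α := ℝ)
  let := Matrix.linftyOpNormedAlgebra (n := Fin m) (R := ℝ) (α := ℝ)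
  have hc : Continuous fun M : Matrix (Fin m) (Fin m) ℝ => M.trace := by fun_prop
  refine le_of_tendsto ((hc.tendsto _).comp (tendsto_exp_mul_exp_pow A B))
    (Eventually.of_forall fun k => ?_)
  have h := (trace_pow_two_pow_aux k).2 (NormedSpace.exp (((2 : ℝ) ^ k)⁻¹ • A))
    (NormedSpace.exp (((2 : ℝ) ^ k)⁻¹ • B))
    (by rw [← Matrix.exp_transpose, Matrix.transpose_smul, hA])
    (by rw [← Matrix.exp_transpose, Matrix.transpose_smul, hB])
  rwa [exp_smul_pow_two_pow, exp_smul_pow_two_pow] at h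

end GoldenThompson

/-! ### Matrix exponentials of rank one updates and of symmetric matrices. -/

section ExpBounds

variable {m : ℕ}

theorem exp_smul_of_isIdempotentElem {𝔸 : Type*} [NormedRing 𝔸] [NormedAlgebra ℝ 𝔸]
    [CompleteSpace 𝔸] {p : 𝔸} (hp : p * p = p) (t : ℝ) :
    NormedSpace.exp (t • p) = 1 + (Real.exp t - 1) • p := by
  have h1 : HasSum (fun n : ℕ => ((n.factorial : ℝ)⁻¹ * t ^ n) • p) (Real.exp t • p) := by
    refine HasSum.smul_const ?_ p
    have := NormedSpace.exp_series_hasSum_exp' (𝕂 := ℝ) t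
    rwa [← Real.exp_eq_exp_ℝ] at this
  have h2 : HasSum (fun n : ℕ => if n = 0 then 1 - p else 0) (1 - p) := hasSum_ite_eq 0 (1 - p)
  have h3 := NormedSpace.exp_series_hasSum_exp' (𝕂 := ℝ) (t • p)
  have h4 := h1.add h2
  have e : (fun n : ℕ => ((n.factorial : ℝ)⁻¹ * t ^ n) • p + if n = 0 then 1 - p else 0)
      = fun n : ℕ => (n.factorial : ℝ)⁻¹ • (t • p) ^ n := by
    funext n
    cases n with
    | zero => simp
    | succ n =>
      have : ∀ n : ℕ, p ^ (n + 1) = p := fun n => by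
        induction n with
        | zero => simp
        | succ n ih => rw [pow_succ, ih, hp]
      simp [smul_pow, this, smul_smul]
  rw [e] at h4
  rw [h3.unique h4, sub_smul, one_smul]
  abel

/-- The matrix v vᵀ/|v|² is idempotent, and the exponential of a multiple of an idempotent is affine
in it. -/
theorem exp_neg_smul_vecMulVec (v : Fin m → ℝ) (θ : ℝ) (hv : v ⬝ᵥ v ≠ 0) :
    NormedSpace.exp (-θ • vecMulVec v v)
      = 1 - ((1 - Real.exp (-θ * (v ⬝ᵥ v))) / (v ⬝ᵥ v)) • vecMulVec v v := by
  let := Matrix.linftyOpNormedRing (n := Fin m) (α := ℝ)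
  let := Matrix.linftyOpNormedAlgebra (n := Fin m) (R := ℝ) (α := ℝ)
  have hp : ((v ⬝ᵥ v)⁻¹ • vecMulVec v v) * ((v ⬝ᵥ v)⁻¹ • vecMulVec v v)
      = (v ⬝ᵥ v)⁻¹ • vecMulVec v v := by
    rw [smul_mul_smul_comm, vecMulVec_mul_vecMulVec, vecMulVec_smul, smul_smul,
      mul_assoc, inv_mul_cancel₀ hv, mul_one]
  have h := exp_smul_of_isIdempotentElem hp (-θ * (v ⬝ᵥ v))
  rw [smul_smul, mul_assoc, mul_inv_cancel₀ hv, mul_one, smul_smul] at h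
  refine h.trans ?_
  rw [sub_eq_add_neg 1 (_ • _), ← neg_smul]
  congr 2
  ring

theorem exp_eq_sq (A : Matrix (Fin m) (Fin m) ℝ) :
    NormedSpace.exp A = NormedSpace.exp ((2 : ℝ)⁻¹ • A) * NormedSpace.exp ((2 : ℝ)⁻¹ • A) := by
  have h := exp_smul_pow_two_pow A 1
  rwa [pow_one, pow_one, pow_two, eq_comm] at h

theorem exp_transpose_of_symm {A : Matrix (Fin m) (Fin m) ℝ} (hA : Aᵀ = A) :
    (NormedSpace.exp A)ᵀ = NormedSpace.exp A := by
  rw [← Matrix.exp_transpose, hA]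

theorem dotProduct_exp_mulVec_nonneg {A : Matrix (Fin m) (Fin m) ℝ} (hA : Aᵀ = A)
    (v : Fin m → ℝ) : 0 ≤ v ⬝ᵥ NormedSpace.exp A *ᵥ v := by
  have hs : ((2 : ℝ)⁻¹ • A)ᵀ = (2 : ℝ)⁻¹ • A := by rw [Matrix.transpose_smul, hA]
  rw [exp_eq_sq, ← Matrix.mulVec_mulVec, Matrix.dotProduct_mulVec, ← Matrix.mulVec_transpose,
    exp_transpose_of_symm hs]
  exact Finset.sum_nonneg fun i _ => mul_self_nonneg _

theorem trace_exp_nonneg {A : Matrix (Fin m) (Fin m) ℝ} (hA : Aᵀ = A) :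
    0 ≤ (NormedSpace.exp A).trace := by
  refine Finset.sum_nonneg fun i _ => ?_
  simpa using dotProduct_exp_mulVec_nonneg hA (Pi.single i 1)

/-- Convexity: on [0, K] the function s ↦ e^{-θs} lies below its chord. -/
theorem one_sub_exp_div_le {θ K s : ℝ} (hs : 0 < s) (hsK : s ≤ K) :
    (1 - Real.exp (-θ * K)) / K ≤ (1 - Real.exp (-θ * s)) / s := by
  have hK : 0 < K := hs.trans_le hsK
  have h := convexOn_exp.2 (Set.mem_univ (-θ * K)) (Set.mem_univ (0 : ℝ))
    (show 0 ≤ s / K by positivity) (show 0 ≤ 1 - s / K by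
      rw [sub_nonneg, div_le_one hK]; exact hsK)
    (by ring)
  have e : (s / K) • (-θ * K) + (1 - s / K) • (0 : ℝ) = -θ * s := by
    simp only [smul_eq_mul]; field_simp; ring
  rw [e, Real.exp_zero] at h
  rw [div_le_div_iff₀ hK hs]
  simp only [smul_eq_mul, mul_one] at h
  have h2 := mul_le_mul_of_nonneg_right h hK.le
  have e2 : (s / K * Real.exp (-θ * K) + (1 - s / K)) * K = s * Real.exp (-θ * K) + K - s := by
    field_simp; ring
  rw [e2] at h2
  linarith

/-- For symmetric `A` and `|v|² ≤ K`, a rank one update decreases the trace exponential. -/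
theorem trace_exp_sub_le [NeZero m] {A : Matrix (Fin m) (Fin m) ℝ} (hA : Aᵀ = A)
    (v : Fin m → ℝ) {θ K : ℝ} (hv : v ⬝ᵥ v ≤ K) :
    (NormedSpace.exp (A - θ • vecMulVec v v)).trace
      ≤ (NormedSpace.exp A).trace
        - (1 - Real.exp (-θ * K)) / K * (v ⬝ᵥ NormedSpace.exp A *ᵥ v) := by
  by_cases h0 : v ⬝ᵥ v = 0
  · have : v = 0 := by simpa using h0
    subst this
    simp
  have hpos : 0 < v ⬝ᵥ v :=
    lt_of_le_of_ne (Finset.sum_nonneg fun i _ => mul_self_nonneg _) (Ne.symm h0)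
  have hX : (-θ • vecMulVec v v)ᵀ = -θ • vecMulVec v v := by
    rw [Matrix.transpose_smul, Matrix.transpose_vecMulVec]
  -- Golden–Thompson splits off the rank one factor, whose exponential is explicit. Its coefficient
  -- depends on |v|² and is smallest when |v|² is replaced by K.
  have h := golden_thompson hA hX
  rw [exp_neg_smul_vecMulVec v θ h0, Matrix.mul_sub, mul_one, Matrix.mul_smul, Matrix.trace_sub,
    Matrix.trace_smul, Matrix.mul_vecMulVec, Matrix.trace_vecMulVec,
    dotProduct_comm (NormedSpace.exp A *ᵥ v) v, smul_eq_mul] at h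
  rw [sub_eq_add_neg A, ← neg_smul]
  refine h.trans (sub_le_sub_left ?_ _)
  exact mul_le_mul_of_nonneg_right (one_sub_exp_div_le hpos hv) (dotProduct_exp_mulVec_nonneg hA v)

/-- The last clause transfers lower bounds between the diagonal entries and the spectrum, in terms
of which `lambdaMin` is defined. -/
theorem exists_orthogonal_diagonalization {S : Matrix (Fin m) (Fin m) ℝ} (hS : Sᵀ = S) :
    ∃ (U : Matrix (Fin m) (Fin m) ℝ) (d : Fin m → ℝ), Uᵀ * U = 1 ∧ U * Uᵀ = 1 ∧
      S = U * diagonal d * Uᵀ ∧ ∀ t, (∀ i, t ≤ d i) ↔ ∀ s ∈ spectrum ℝ S, t ≤ s := by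
  have hH : S.IsHermitian := by
    rw [Matrix.IsHermitian, Matrix.conjTranspose_eq_transpose_of_trivial, hS]
  refine ⟨hH.eigenvectorUnitary, hH.eigenvalues, ?_, ?_, ?_, ?_⟩
  · have := (Matrix.mem_unitaryGroup_iff').1 hH.eigenvectorUnitary.2
    rwa [Matrix.star_eq_conjTranspose, Matrix.conjTranspose_eq_transpose_of_trivial] at this
  · have := (Matrix.mem_unitaryGroup_iff).1 hH.eigenvectorUnitary.2
    rwa [Matrix.star_eq_conjTranspose, Matrix.conjTranspose_eq_transpose_of_trivial] at this
  · have := hH.spectral_theorem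
    rw [Unitary.conjStarAlgAut_apply, Matrix.star_eq_conjTranspose,
      Matrix.conjTranspose_eq_transpose_of_trivial] at this
    exact this
  · intro t
    rw [hH.spectrum_real_eq_range_eigenvalues]
    simp

theorem dotProduct_diagonal_conj (U : Matrix (Fin m) (Fin m) ℝ) (d a : Fin m → ℝ) :
    a ⬝ᵥ (U * diagonal d * Uᵀ) *ᵥ a = ∑ i, d i * (Uᵀ *ᵥ a) i ^ 2 := by
  rw [← Matrix.mulVec_mulVec, ← Matrix.mulVec_mulVec, Matrix.dotProduct_mulVec,
    ← Matrix.mulVec_transpose, dotProduct]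
  exact Finset.sum_congr rfl fun i _ => by rw [Matrix.mulVec_diagonal]; ring

theorem dotProduct_self_eq_sum {U : Matrix (Fin m) (Fin m) ℝ} (hU : U * Uᵀ = 1) (a : Fin m → ℝ) :
    a ⬝ᵥ a = ∑ i, (Uᵀ *ᵥ a) i ^ 2 := by
  have h := dotProduct_diagonal_conj U (fun _ => 1) a
  simpa [hU, Matrix.diagonal_one] using h

/-- A Rayleigh quotient at most t forces some eigenvalue to be at most t, and its exponential is one
of the positive terms of the trace. -/
theorem exp_le_trace_exp {S : Matrix (Fin m) (Fin m) ℝ} (hS : Sᵀ = S) {θ t : ℝ} (hθ : 0 ≤ θ)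
    {a : Fin m → ℝ} (ha : a ≠ 0) (h : a ⬝ᵥ S *ᵥ a ≤ t * (a ⬝ᵥ a)) :
    Real.exp (-θ * t) ≤ (NormedSpace.exp (-θ • S)).trace := by
  obtain ⟨U, d, hU, hU', rfl, -⟩ := exists_orthogonal_diagonalization hS
  obtain ⟨i, hi⟩ : ∃ i, d i ≤ t := by
    by_contra! hd
    rw [dotProduct_diagonal_conj, dotProduct_self_eq_sum hU', Finset.mul_sum] at h
    have hz := (Finset.sum_eq_zero_iff_of_nonneg (fun i _ => mul_nonneg (sub_nonneg.2 (hd i).le)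
      (sq_nonneg ((Uᵀ *ᵥ a) i)))).1 (le_antisymm
        (by simp only [sub_mul, Finset.sum_sub_distrib]; linarith)
        (Finset.sum_nonneg fun i _ => mul_nonneg (sub_nonneg.2 (hd i).le) (sq_nonneg _)))
    have hz2 : a ⬝ᵥ a = 0 := by
      rw [dotProduct_self_eq_sum hU']
      refine Finset.sum_eq_zero fun i hi => ?_
      exact (mul_eq_zero.1 (hz i hi)).resolve_left (sub_pos.2 (hd i)).ne'
    exact ha (by simpa using hz2)
  have hinv : U⁻¹ = Uᵀ := Matrix.inv_eq_right_inv hU'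
  have e : NormedSpace.exp (-θ • (U * diagonal d * Uᵀ))
      = U * diagonal (fun i => Real.exp (-θ * d i)) * Uᵀ := by
    rw [← hinv, ← Matrix.smul_mul, ← Matrix.mul_smul, Matrix.exp_conj _ _
      (IsUnit.of_mul_eq_one _ hU'), ← Matrix.diagonal_smul, Matrix.exp_diagonal]
    congr 3
    funext i
    rw [Pi.coe_exp, Real.exp_eq_exp_ℝ]
    rfl
  rw [e, Matrix.trace_mul_comm, ← mul_assoc, hU, one_mul, Matrix.trace_diagonal]
  calc Real.exp (-θ * t) ≤ Real.exp (-θ * d i) :=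
        Real.exp_le_exp.2 (mul_le_mul_of_nonpos_left hi (by linarith))
    _ ≤ _ := Finset.single_le_sum (f := fun i => Real.exp (-θ * d i))
        (fun i _ => (Real.exp_pos _).le) (Finset.mem_univ i)

end ExpBounds

/-! ### Matrix Chernoff bound for i.i.d. isotropic vectors. -/

/-- The random vector `v` has second moment matrix the identity under `ν`. -/
structure IsIsotropic {X : Type*} [MeasurableSpace X] (ν : Measure X) {m : ℕ}
    (v : X → Fin m → ℝ) : Prop where
  measurable : Measurable v
  integrable : ∀ j k, Integrable (fun x => v x j * v x k) ν
  integral_eq : ∀ j k, ∫ x, v x j * v x k ∂ν = if j = k then 1 else 0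

/-- The sum `∑ i ∈ s, v(x_i) v(x_i)ᵀ`. -/
def sumOuter {X ι : Type*} {m : ℕ} (v : X → Fin m → ℝ) (s : Finset ι) (x : ι → X) :
    Matrix (Fin m) (Fin m) ℝ :=
  ∑ i ∈ s, vecMulVec (v (x i)) (v (x i))

section Chernoff

variable {X : Type*} {m : ℕ}

theorem sumOuter_transpose {ι : Type*} (v : X → Fin m → ℝ) (s : Finset ι) (x : ι → X) :
    (sumOuter v s x)ᵀ = sumOuter v s x := by
  simp [sumOuter, Matrix.transpose_sum, Matrix.transpose_vecMulVec]

theorem dotProduct_sumOuter {ι : Type*} (v : X → Fin m → ℝ) (s : Finset ι) (x : ι → X)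
    (a : Fin m → ℝ) : a ⬝ᵥ sumOuter v s x *ᵥ a = ∑ i ∈ s, (v (x i) ⬝ᵥ a) ^ 2 := by
  rw [sumOuter, Matrix.sum_mulVec, dotProduct_sum]
  refine Finset.sum_congr rfl fun i _ => ?_
  rw [Matrix.vecMulVec_mulVec, dotProduct_smul, dotProduct_comm a]
  simp [pow_two]

variable [MeasurableSpace X]

theorem measurable_trace_exp {Y : Type*} [MeasurableSpace Y] {g : Y → Matrix (Fin m) (Fin m) ℝ}
    (hg : ∀ j k, Measurable fun y => g y j k) :
    Measurable fun y => (NormedSpace.exp (g y)).trace := by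
  have hc : Continuous fun M : Matrix (Fin m) (Fin m) ℝ => (NormedSpace.exp M).trace := by
    let := Matrix.linftyOpNormedRing (n := Fin m) (α := ℝ)
    let := Matrix.linftyOpNormedAlgebra (n := Fin m) (R := ℝ) (α := ℝ)
    let := NormedAlgebra.restrictScalars ℚ ℝ (Matrix (Fin m) (Fin m) ℝ)
    have h1 : Continuous fun M : Matrix (Fin m) (Fin m) ℝ => M.trace := by fun_prop
    exact h1.comp NormedSpace.exp_continuous
  have hc' : Measurable fun M : Fin m → Fin m → ℝ =>
      (NormedSpace.exp (Matrix.of M)).trace := by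
    have hof : Continuous fun M : Fin m → Fin m → ℝ => Matrix.of M :=
      continuous_matrix fun i j => by simp only [Matrix.of_apply]; fun_prop
    exact (hc.comp hof).measurable
  exact hc'.comp (measurable_pi_lambda _ fun j => measurable_pi_lambda _ fun k => hg j k)

theorem measurable_sumOuter_apply {ι : Type*} {v : X → Fin m → ℝ} (hv : Measurable v)
    (s : Finset ι) (j k : Fin m) : Measurable fun x : ι → X => sumOuter v s x j k := by
  simp only [sumOuter, Matrix.sum_apply, Matrix.vecMulVec_apply]
  fun_prop

theorem integral_dotProduct_mulVec {ν : Measure X} {v : X → Fin m → ℝ} (hv : IsIsotropic ν v)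
    (E : Matrix (Fin m) (Fin m) ℝ) :
    Integrable (fun x => v x ⬝ᵥ E *ᵥ v x) ν ∧ ∫ x, v x ⬝ᵥ E *ᵥ v x ∂ν = E.trace := by
  have e : ∀ x, v x ⬝ᵥ E *ᵥ v x = ∑ j, ∑ k, E j k * (v x j * v x k) := fun x => by
    simp only [dotProduct, Matrix.mulVec, Finset.mul_sum]
    exact Finset.sum_congr rfl fun j _ => Finset.sum_congr rfl fun k _ => by ring
  simp only [e]
  have hi : ∀ j k, Integrable (fun x => E j k * (v x j * v x k)) ν :=
    fun j k => (hv.integrable j k).const_mul _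
  refine ⟨integrable_finsetSum _ fun j _ => integrable_finsetSum _ fun k _ => hi j k, ?_⟩
  rw [integral_finsetSum _ fun j _ => integrable_finsetSum _ fun k _ => hi j k]
  simp_rw [integral_finsetSum _ fun k _ => hi _ k, integral_const_mul, hv.integral_eq]
  simp [Matrix.trace]

/-- Isotropy averages the quadratic form v·e^A v to tr e^A, so subtracting one random rank one term
costs a scalar factor. -/
theorem lintegral_trace_exp_sub_le [NeZero m] {ν : Measure X} [IsProbabilityMeasure ν]
    {v : X → Fin m → ℝ} (hv : IsIsotropic ν v) {A : Matrix (Fin m) (Fin m) ℝ} (hA : Aᵀ = A)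
    (θ : ℝ) {K : ℝ} (hK : ∀ x, v x ⬝ᵥ v x ≤ K) :
    ∫⁻ x, ENNReal.ofReal (NormedSpace.exp (A - θ • vecMulVec (v x) (v x))).trace ∂ν
      ≤ ENNReal.ofReal (NormedSpace.exp A).trace
        * ENNReal.ofReal (1 - (1 - Real.exp (-θ * K)) / K) := by
  obtain ⟨hi, he⟩ := integral_dotProduct_mulVec hv (NormedSpace.exp A)
  set c := (1 - Real.exp (-θ * K)) / K
  have hle := fun x => trace_exp_sub_le (θ := θ) hA (v x) (hK x)
  have hsymm : ∀ x, (A - θ • vecMulVec (v x) (v x))ᵀ = A - θ • vecMulVec (v x) (v x) := fun x => by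
    rw [Matrix.transpose_sub, Matrix.transpose_smul, Matrix.transpose_vecMulVec, hA]
  have hint : Integrable (fun x => (NormedSpace.exp A).trace
      - c * (v x ⬝ᵥ NormedSpace.exp A *ᵥ v x)) ν := (integrable_const _).sub (hi.const_mul c)
  calc _ ≤ ∫⁻ x, ENNReal.ofReal ((NormedSpace.exp A).trace
        - c * (v x ⬝ᵥ NormedSpace.exp A *ᵥ v x)) ∂ν :=
        lintegral_mono fun x => ENNReal.ofReal_le_ofReal (hle x)
    _ = ENNReal.ofReal ((NormedSpace.exp A).trace * (1 - c)) := by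
        rw [← ofReal_integral_eq_lintegral_ofReal hint
          (Eventually.of_forall fun x => (trace_exp_nonneg (hsymm x)).trans (hle x)),
          integral_sub (integrable_const _) (hi.const_mul c), integral_const_mul, he]
        simp [mul_sub, mul_comm]
    _ = _ := ENNReal.ofReal_mul (trace_exp_nonneg hA)

/-- The points are integrated out one at a time; the sum over the points not yet integrated is
absorbed into the fixed symmetric matrix. -/
theorem lmarginal_trace_exp_le [NeZero m] {ν : Measure X} [IsProbabilityMeasure ν]
    {v : X → Fin m → ℝ} (hv : IsIsotropic ν v) {A : Matrix (Fin m) (Fin m) ℝ} (hA : Aᵀ = A)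
    (θ : ℝ) {K : ℝ} (hK : ∀ x, v x ⬝ᵥ v x ≤ K) {ι : Type*} [DecidableEq ι] (s : Finset ι)
    (x : ι → X) :
    (∫⋯∫⁻_s, (fun x : ι → X =>
        ENNReal.ofReal (NormedSpace.exp (A - θ • sumOuter v s x)).trace) ∂(fun _ : ι => ν)) x
      ≤ ENNReal.ofReal (NormedSpace.exp A).trace
        * ENNReal.ofReal (1 - (1 - Real.exp (-θ * K)) / K) ^ s.card := by
  set c := (1 - Real.exp (-θ * K)) / K
  have hmeas : ∀ s : Finset ι, Measurable fun x : ι → X =>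
      ENNReal.ofReal (NormedSpace.exp (A - θ • sumOuter v s x)).trace := fun s => by
    refine (measurable_trace_exp fun j k => ?_).ennreal_ofReal
    have := measurable_sumOuter_apply hv.measurable s j k
    simp only [Matrix.sub_apply, Matrix.smul_apply]
    fun_prop
  induction s using Finset.induction_on generalizing x with
  | empty => simp [sumOuter]
  | insert i s his ih =>
    rw [lmarginal_insert' _ (hmeas _) his, Finset.card_insert_of_notMem his]
    have hstep : (fun x : ι → X => ∫⁻ xi, ENNReal.ofReal
        (NormedSpace.exp (A - θ • sumOuter v (insert i s) (Function.update x i xi))).trace ∂ν)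
        ≤ fun x => ENNReal.ofReal (NormedSpace.exp (A - θ • sumOuter v s x)).trace
          * ENNReal.ofReal (1 - c) := fun x => by
      have e : ∀ xi, A - θ • sumOuter v (insert i s) (Function.update x i xi)
          = (A - θ • sumOuter v s x) - θ • vecMulVec (v xi) (v xi) := fun xi => by
        have e2 : ∑ j ∈ s, vecMulVec (v (Function.update x i xi j)) (v (Function.update x i xi j))
            = ∑ j ∈ s, vecMulVec (v (x j)) (v (x j)) := by
          refine Finset.sum_congr rfl fun j hj => ?_
          rw [Function.update_of_ne (ne_of_mem_of_not_mem hj his)]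
        rw [sumOuter, Finset.sum_insert his, Function.update_self, e2, sumOuter, smul_add]
        abel
      simp only [e]
      refine lintegral_trace_exp_sub_le hv ?_ θ hK
      rw [Matrix.transpose_sub, Matrix.transpose_smul, sumOuter_transpose, hA]
    refine (lmarginal_mono hstep x).trans ?_
    have hmul : (∫⋯∫⁻_s, (fun x : ι → X =>
        ENNReal.ofReal (NormedSpace.exp (A - θ • sumOuter v s x)).trace * ENNReal.ofReal (1 - c))
          ∂(fun _ : ι => ν)) x = (∫⋯∫⁻_s, (fun x : ι → X =>
        ENNReal.ofReal (NormedSpace.exp (A - θ • sumOuter v s x)).trace) ∂(fun _ : ι => ν)) x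
          * ENNReal.ofReal (1 - c) := by
      simp only [lmarginal]
      exact lintegral_mul_const' _ _ ENNReal.ofReal_ne_top
    rw [hmul, pow_succ, ← mul_assoc]
    gcongr
    exact ih x

/-- The Laplace transform bound behind the matrix Chernoff inequality. -/
theorem lintegral_trace_exp_neg_sumOuter_le [NeZero m] {ν : Measure X} [IsProbabilityMeasure ν]
    {v : X → Fin m → ℝ} (hv : IsIsotropic ν v) (θ : ℝ) {K : ℝ} (hK : ∀ x, v x ⬝ᵥ v x ≤ K)
    (ι : Type*) [Fintype ι] :
    ∫⁻ x : ι → X, ENNReal.ofReal (NormedSpace.exp (-θ • sumOuter v Finset.univ x)).trace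
        ∂(Measure.pi fun _ => ν)
      ≤ ENNReal.ofReal (m * Real.exp (-((1 - Real.exp (-θ * K)) / K) * Fintype.card ι)) := by
  classical
  obtain ⟨x₀⟩ : Nonempty (ι → X) := ⟨fun _ => ν.nonempty_of_neZero.some⟩
  -- Starting from A = 0 gives tr e^A = m; the powers of 1 - c then become exponentials by 1 - c ≤
  -- e^{-c}.
  have h := lmarginal_trace_exp_le hv (A := 0) (by simp) θ hK (Finset.univ : Finset ι) x₀
  rw [lmarginal_univ] at h
  simp only [zero_sub, ← neg_smul] at h
  refine h.trans ?_
  rw [NormedSpace.exp_zero, Matrix.trace_one, Fintype.card_fin, Finset.card_univ,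
    ENNReal.ofReal_mul (by positivity), mul_comm _ (Fintype.card ι : ℝ), Real.exp_nat_mul,
    ENNReal.ofReal_pow (Real.exp_pos _).le]
  gcongr
  linarith [Real.add_one_le_exp (-((1 - Real.exp (-θ * K)) / K))]

end Chernoff

/-! ### Cauchy–Binet. -/

section Determinants

/-- Row j of ΦᵀΦ is a combination of the rows of Φ with weights Φ i j; the determinant is expanded
by multilinearity in the rows. -/
theorem det_transpose_mul_self_eq_sum {ι : Type*} [Fintype ι] {m : ℕ}
    (Φ : Matrix ι (Fin m) ℝ) :
    (Φᵀ * Φ).det = ∑ f : Fin m → ι, (∏ j, Φ (f j) j) * (Φ.submatrix f id).det := by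
  classical
  have h1 : (Φᵀ * Φ).det
      = (Matrix.detRowAlternating (n := Fin m) (R := ℝ)).toMultilinearMap
        (fun j => ∑ i, Φ i j • Φ i) := by
    change (Φᵀ * Φ).det = Matrix.det (Matrix.of fun j => ∑ i, Φ i j • Φ i)
    congr 1
    ext j k
    simp [Matrix.mul_apply]
  rw [h1, MultilinearMap.map_sum]
  refine Finset.sum_congr rfl fun f _ => ?_
  rw [MultilinearMap.map_smul_univ, smul_eq_mul]
  rfl

/-- The Cauchy–Binet formula for a Gram determinant. -/
theorem factorial_mul_det_transpose_mul_self {ι : Type*} [Fintype ι] {m : ℕ}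
    (Φ : Matrix ι (Fin m) ℝ) :
    (m.factorial : ℝ) * (Φᵀ * Φ).det = ∑ f : Fin m ↪ ι, (Φ.submatrix f id).det ^ 2 := by
  classical
  have h1 : ∑ f : Fin m ↪ ι, (Φ.submatrix f id).det ^ 2
      = ∑ f : Fin m → ι, (Φ.submatrix f id).det ^ 2 := by
    refine Fintype.sum_of_injective (fun f : Fin m ↪ ι => (f : Fin m → ι))
      DFunLike.coe_injective _ _ (fun f hf => ?_) fun f => rfl
    have hinj : ¬ Function.Injective f := fun h => hf ⟨⟨f, h⟩, rfl⟩
    simp only [Function.Injective, not_forall] at hinj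
    obtain ⟨a, b, hab, hne⟩ := hinj
    rw [Matrix.det_zero_of_row_eq hne (by ext k; simp [hab]), zero_pow two_ne_zero]
  -- Reindexing by f ∘ σ puts the sign of σ on the minor. Summing over all σ rebuilds a second copy
  -- of the minor by the Leibniz formula and produces the factor m!.
  have h2 : ∀ σ : Equiv.Perm (Fin m), (Φᵀ * Φ).det = ∑ f : Fin m → ι,
      ((Equiv.Perm.sign σ : ℤ) : ℝ) * (∏ j, Φ (f (σ j)) j) * (Φ.submatrix f id).det := fun σ => by
    rw [det_transpose_mul_self_eq_sum,
      ← (Equiv.arrowCongr σ.symm (Equiv.refl ι)).sum_comp]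
    refine Finset.sum_congr rfl fun f _ => ?_
    have e : (Equiv.arrowCongr σ.symm (Equiv.refl ι)) f = f ∘ σ := by
      ext j; simp [Equiv.arrowCongr]
    have e2 : (Φ.submatrix (f ∘ σ) id).det
        = ((Equiv.Perm.sign σ : ℤ) : ℝ) * (Φ.submatrix f id).det :=
      Matrix.det_permute σ (Φ.submatrix f id)
    rw [e, e2]
    simp only [Function.comp_apply]
    ring
  rw [h1]
  calc (m.factorial : ℝ) * (Φᵀ * Φ).det = ∑ _σ : Equiv.Perm (Fin m), (Φᵀ * Φ).det := by
        simp [Finset.card_univ, Fintype.card_perm]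
    _ = ∑ σ : Equiv.Perm (Fin m), ∑ f : Fin m → ι, ((Equiv.Perm.sign σ : ℤ) : ℝ)
          * (∏ j, Φ (f (σ j)) j) * (Φ.submatrix f id).det :=
        Finset.sum_congr rfl fun σ _ => h2 σ
    _ = _ := by
        rw [Finset.sum_comm]
        refine Finset.sum_congr rfl fun f _ => ?_
        rw [← Finset.sum_mul, pow_two]
        congr 1
        rw [Matrix.det_apply']
        rfl

end Determinants

/-! ### Second moments of determinants and adjugates; independence of selected points. -/

section DeterminantIntegrals

variable {X : Type*} [MeasurableSpace X] {m : ℕ}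

/-- The second moment of a determinant with independent rows, each with a diagonal second
moment matrix. -/
theorem integral_det_sq {ν : Measure X} [SigmaFinite ν] {r : Fin m → X → Fin m → ℝ}
    {d : Fin m → Fin m → ℝ} (hi : ∀ k a b, Integrable (fun y => r k y a * r k y b) ν)
    (hd : ∀ k a b, ∫ y, r k y a * r k y b ∂ν = if a = b then d k a else 0) :
    Integrable (fun y : Fin m → X => (Matrix.of fun k a => r k (y k) a).det ^ 2)
        (Measure.pi fun _ => ν) ∧
      ∫ y : Fin m → X, (Matrix.of fun k a => r k (y k) a).det ^ 2 ∂(Measure.pi fun _ => ν)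
        = ∑ σ : Equiv.Perm (Fin m), ∏ k, d k (σ k) := by
  have e : ∀ y : Fin m → X, (Matrix.of fun k a => r k (y k) a).det ^ 2
      = ∑ σ : Equiv.Perm (Fin m), ∑ τ : Equiv.Perm (Fin m),
        (((Equiv.Perm.sign σ : ℤ) : ℝ) * ((Equiv.Perm.sign τ : ℤ) : ℝ))
          * ∏ k, (r k (y k) (σ k) * r k (y k) (τ k)) := fun y => by
    rw [← Matrix.det_transpose, Matrix.det_apply', pow_two, Finset.sum_mul_sum]
    refine Finset.sum_congr rfl fun σ _ => Finset.sum_congr rfl fun τ _ => ?_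
    simp only [Matrix.transpose_apply, Matrix.of_apply, Finset.prod_mul_distrib]
    ring
  simp only [e]
  have hI : ∀ σ τ : Equiv.Perm (Fin m), Integrable (fun y : Fin m → X =>
      (((Equiv.Perm.sign σ : ℤ) : ℝ) * ((Equiv.Perm.sign τ : ℤ) : ℝ))
        * ∏ k, (r k (y k) (σ k) * r k (y k) (τ k))) (Measure.pi fun _ => ν) := fun σ τ =>
    (Integrable.fintype_prod (f := fun k z => r k z (σ k) * r k z (τ k))
      fun k => hi k (σ k) (τ k)).const_mul _
  refine ⟨integrable_finsetSum _ fun σ _ => integrable_finsetSum _ fun τ _ => hI σ τ, ?_⟩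
  rw [integral_finsetSum _ fun σ _ => integrable_finsetSum _ fun τ _ => hI σ τ]
  refine Finset.sum_congr rfl fun σ _ => ?_
  rw [integral_finsetSum _ fun τ _ => hI σ τ, Finset.sum_eq_single σ]
  · rw [integral_const_mul,
      integral_fintype_prod_eq_prod (fun k z => r k z (σ k) * r k z (σ k))]
    simp only [hd, if_true, ← Int.cast_mul, Int.units_mul_self, ← Units.val_mul]
    simp
  · intro τ _ hne
    -- Off-diagonal pairs vanish: in a row where σ and τ differ the mixed moment is zero.
    obtain ⟨k, hk⟩ : ∃ k, σ k ≠ τ k := by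
      by_contra! h
      exact hne (Equiv.ext fun k => (h k).symm)
    rw [integral_const_mul,
      integral_fintype_prod_eq_prod (fun k z => r k z (σ k) * r k z (τ k))]
    simp only [hd]
    rw [Finset.prod_eq_zero (Finset.mem_univ k) (if_neg hk), mul_zero]
  · simp

/-- The square matrix with rows `v(y_k)`. -/
def rowMatrix (v : X → Fin m → ℝ) (y : Fin m → X) : Matrix (Fin m) (Fin m) ℝ :=
  Matrix.of fun k a => v (y k) a

/-- The squared Frobenius norm of the adjugate of `rowMatrix v y`. -/
def adjugateSq (v : X → Fin m → ℝ) (y : Fin m → X) : ℝ :=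
  ∑ j, ∑ i, (rowMatrix v y).adjugate i j ^ 2

theorem lintegral_det_sq {ν : Measure X} [SigmaFinite ν] {v : X → Fin m → ℝ}
    (hv : IsIsotropic ν v) :
    ∫⁻ y : Fin m → X, ENNReal.ofReal ((rowMatrix v y).det ^ 2) ∂(Measure.pi fun _ => ν)
      = ENNReal.ofReal m.factorial := by
  obtain ⟨hI, he⟩ := integral_det_sq (ν := ν) (r := fun _ => v) (d := fun _ _ => 1)
    (fun _ => hv.integrable) (fun _ => hv.integral_eq)
  have h := ofReal_integral_eq_lintegral_ofReal hI (Eventually.of_forall fun _ => sq_nonneg _)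
  rw [he] at h
  refine h.symm.trans ?_
  simp [Finset.card_univ, Fintype.card_perm]

/-- The entry (i, j) of the adjugate is a determinant whose row j is the constant e_i, with diagonal
second moment; `integral_det_sq` lets the row laws differ for this purpose. Its mean square counts
the permutations sending j to i, and for fixed j the sum over i is m!. -/
theorem lintegral_adjugateSq {ν : Measure X} [IsProbabilityMeasure ν] {v : X → Fin m → ℝ}
    (hv : IsIsotropic ν v) :
    ∫⁻ y : Fin m → X, ENNReal.ofReal (adjugateSq v y) ∂(Measure.pi fun _ => ν)
      = ENNReal.ofReal (m * m.factorial) := by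
  have key : ∀ i j : Fin m,
      Integrable (fun y : Fin m → X => (rowMatrix v y).adjugate i j ^ 2) (Measure.pi fun _ => ν) ∧
      ∫ y : Fin m → X, (rowMatrix v y).adjugate i j ^ 2 ∂(Measure.pi fun _ => ν)
        = ∑ σ : Equiv.Perm (Fin m), if σ j = i then 1 else 0 := fun i j => by
    have h := integral_det_sq (ν := ν)
      (r := fun k y a => if k = j then (Pi.single i 1 : Fin m → ℝ) a else v y a)
      (d := fun k a => if k = j then (if a = i then 1 else 0) else 1)
      (fun k a b => by
        by_cases hk : k = j
        · simp only [hk, if_true]; exact integrable_const _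
        · simpa only [hk, if_false] using hv.integrable a b)
      (fun k a b => by
        by_cases hk : k = j
        · simp only [hk, if_true, integral_const, probReal_univ, one_smul, Pi.single_apply]
          grind
        · simpa only [hk, if_false] using hv.integral_eq a b)
    have e : ∀ y : Fin m → X, (Matrix.of fun k a =>
        if k = j then (Pi.single i 1 : Fin m → ℝ) a else v (y k) a).det
          = (rowMatrix v y).adjugate i j := fun y => by
      rw [Matrix.adjugate_apply]
      congr 1
      ext k a
      simp only [Matrix.of_apply, Matrix.updateRow_apply, rowMatrix]
    simp only [e] at h
    refine ⟨h.1, h.2.trans (Finset.sum_congr rfl fun σ _ => ?_)⟩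
    rw [Finset.prod_ite_eq', if_pos (Finset.mem_univ j)]
  have hI : Integrable (adjugateSq v) (Measure.pi fun _ : Fin m => ν) :=
    integrable_finsetSum _ fun j _ => integrable_finsetSum _ fun i _ => (key i j).1
  rw [← ofReal_integral_eq_lintegral_ofReal hI (Eventually.of_forall fun _ =>
    Finset.sum_nonneg fun _ _ => Finset.sum_nonneg fun _ _ => sq_nonneg _)]
  congr 1
  unfold adjugateSq
  rw [integral_finsetSum _ fun j _ => integrable_finsetSum _ fun i _ => (key i j).1]
  simp_rw [integral_finsetSum _ fun i _ => (key i _).1, (key _ _).2]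
  have hj : ∀ j : Fin m, ∑ i : Fin m, ∑ σ : Equiv.Perm (Fin m), (if σ j = i then (1 : ℝ) else 0)
      = m.factorial := fun j => by
    rw [Finset.sum_comm]
    simp [Finset.card_univ, Fintype.card_perm]
  simp only [hj]
  simp

/-- An index type is the disjoint union of the image of an embedding and its complement. -/
noncomputable def sumComplRangeEquiv {κ ι : Type*} (f : κ ↪ ι) :
    κ ⊕ {i // i ∉ Set.range f} ≃ ι :=
  ((Equiv.ofInjective f f.injective).sumCongr (Equiv.refl _)).trans
    (by classical exact Equiv.Set.sumCompl (Set.range f))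

/-- The coordinates selected by an embedding are independent of the other ones. -/
theorem lintegral_comp_embedding_mul {ν : Measure X} [SigmaFinite ν] {κ ι : Type*} [Fintype κ]
    [Fintype ι] (f : κ ↪ ι) [Fintype {i // i ∉ Set.range f}] {F : (κ → X) → ℝ≥0∞}
    {G : ({i // i ∉ Set.range f} → X) → ℝ≥0∞} (hF : Measurable F) (hG : Measurable G) :
    ∫⁻ x : ι → X, F (fun k => x (f k)) * G (fun i => x i) ∂(Measure.pi fun _ => ν)
      = (∫⁻ y, F y ∂(Measure.pi fun _ => ν)) * ∫⁻ z, G z ∂(Measure.pi fun _ => ν) := by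
  classical
  let e := sumComplRangeEquiv f
  have hmp := (measurePreserving_piCongrLeft (fun _ : ι => ν) e).comp
    (measurePreserving_sumPiEquivProdPi_symm (X := fun _ : κ ⊕ {i // i ∉ Set.range f} => X)
      (fun _ => ν))
  have hF' : Measurable fun x : ι → X => F (fun k => x (f k)) := hF.comp (by fun_prop)
  have hG' : Measurable fun x : ι → X => G (fun i => x i) := hG.comp (by fun_prop)
  refine (hmp.lintegral_comp (hF'.mul hG')).symm.trans ?_
  rw [← lintegral_prod_mul hF.aemeasurable hG.aemeasurable]
  refine lintegral_congr fun p => ?_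
  have hp : ∀ s, (MeasurableEquiv.piCongrLeft (fun _ : ι => X) e
      ((MeasurableEquiv.sumPiEquivProdPi fun _ : κ ⊕ {i // i ∉ Set.range f} => X).symm p)) (e s)
        = Sum.elim p.1 p.2 s := fun s => by
    rw [MeasurableEquiv.piCongrLeft_apply_apply]
    cases s <;> rfl
  simp only [Pi.mul_apply, Function.comp_apply]
  congr 2
  · funext k
    exact hp (Sum.inl k)
  · funext i
    exact hp (Sum.inr i)

end DeterminantIntegrals

/-! ### Volume sampling and the mean inverse bound for one block. -/

section VolumeSampling

variable {X : Type*} {m : ℕ}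

theorem sq_norm_mulVec_le (A : Matrix (Fin m) (Fin m) ℝ) (u : Fin m → ℝ) :
    A *ᵥ u ⬝ᵥ A *ᵥ u ≤ (∑ j, ∑ i, A i j ^ 2) * (u ⬝ᵥ u) := by
  rw [Finset.sum_comm, Finset.sum_mul]
  refine Finset.sum_le_sum fun i _ => ?_
  rw [← pow_two]
  have h := Finset.sum_mul_sq_le_sq_mul_sq Finset.univ (A i) u
  simpa only [dotProduct, Matrix.mulVec, ← pow_two] using h

/-- Cauchy–Schwarz applied to det(V) a = adj(V) V a. -/
theorem det_sq_mul_le (v : X → Fin m → ℝ) (y : Fin m → X) (a : Fin m → ℝ) :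
    (rowMatrix v y).det ^ 2 * (a ⬝ᵥ a) ≤ adjugateSq v y * ∑ k, (v (y k) ⬝ᵥ a) ^ 2 := by
  have h := sq_norm_mulVec_le (rowMatrix v y).adjugate (rowMatrix v y *ᵥ a)
  rw [Matrix.mulVec_mulVec, Matrix.adjugate_mul, Matrix.smul_mulVec, Matrix.one_mulVec,
    smul_dotProduct, dotProduct_smul, smul_eq_mul, smul_eq_mul, ← mul_assoc, ← pow_two] at h
  have e : ∑ k, (v (y k) ⬝ᵥ a) ^ 2 = rowMatrix v y *ᵥ a ⬝ᵥ rowMatrix v y *ᵥ a :=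
    Finset.sum_congr rfl fun k _ => pow_two _
  rwa [e]

theorem adjugateSq_nonneg (v : X → Fin m → ℝ) (y : Fin m → X) : 0 ≤ adjugateSq v y :=
  Finset.sum_nonneg fun _ _ => Finset.sum_nonneg fun _ _ => sq_nonneg _

/-- The contribution of the selection `f` of `m` points to the bound on the inverse Gram matrix. -/
noncomputable def selectionBound (v : X → Fin m → ℝ) {n : ℕ} (t θ : ℝ) (f : Fin m ↪ Fin n)
    (x : Fin n → X) : ℝ :=
  (rowMatrix v fun k => x (f k)).det ^ 2 / t + adjugateSq v (fun k => x (f k)) *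
    (Real.exp (θ * t) * (NormedSpace.exp (-θ • sumOuter v Finset.univ
      (fun i : {i // i ∉ Set.range f} => x i))).trace)

theorem trace_exp_sumOuter_nonneg {ι : Type*} (v : X → Fin m → ℝ) (s : Finset ι) (x : ι → X)
    (θ : ℝ) : 0 ≤ (NormedSpace.exp (-θ • sumOuter v s x)).trace :=
  trace_exp_nonneg (by rw [Matrix.transpose_smul, sumOuter_transpose])

theorem selectionBound_nonneg (v : X → Fin m → ℝ) {n : ℕ} {t : ℝ} (ht : 0 ≤ t) (θ : ℝ)
    (f : Fin m ↪ Fin n) (x : Fin n → X) : 0 ≤ selectionBound v t θ f x :=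
  add_nonneg (by positivity) (mul_nonneg (adjugateSq_nonneg _ _)
    (mul_nonneg (Real.exp_pos _).le (trace_exp_sumOuter_nonneg _ _ _ _)))

theorem det_sq_mul_le_selectionBound (v : X → Fin m → ℝ) {n : ℕ} {t θ M : ℝ} (ht : 0 < t)
    (hθ : 0 ≤ θ) (f : Fin m ↪ Fin n) (x : Fin n → X) (a : Fin m → ℝ)
    (hM : ∑ i, (v (x i) ⬝ᵥ a) ^ 2 ≤ M) :
    (rowMatrix v fun k => x (f k)).det ^ 2 * (a ⬝ᵥ a) ≤ M * selectionBound v t θ f x := by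
  have hsplit : ∑ k, (v (x (f k)) ⬝ᵥ a) ^ 2
      + ∑ i : {i // i ∉ Set.range f}, (v (x i) ⬝ᵥ a) ^ 2 = ∑ i, (v (x i) ⬝ᵥ a) ^ 2 := by
    rw [← (sumComplRangeEquiv f).sum_comp, Fintype.sum_sum_type]
    rfl
  have h1 : 0 ≤ ∑ k, (v (x (f k)) ⬝ᵥ a) ^ 2 := Finset.sum_nonneg fun _ _ => sq_nonneg _
  have h2 : 0 ≤ ∑ i : {i // i ∉ Set.range f}, (v (x i) ⬝ᵥ a) ^ 2 :=
    Finset.sum_nonneg fun _ _ => sq_nonneg _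
  have hM0 : 0 ≤ M := by linarith
  have hT := trace_exp_sumOuter_nonneg v Finset.univ
    (fun i : {i // i ∉ Set.range f} => x i) θ
  have hadj := adjugateSq_nonneg v fun k => x (f k)
  rw [selectionBound, mul_add]
  set S := sumOuter v Finset.univ (fun i : {i // i ∉ Set.range f} => x i) with hS
  -- Either the unselected points control the direction a, or the trace exponential certifies the
  -- failure and the selected points are used.
  by_cases hc : t * (a ⬝ᵥ a) ≤ a ⬝ᵥ S *ᵥ a
  · rw [hS, dotProduct_sumOuter] at hc
    have h3 : a ⬝ᵥ a ≤ M / t := by rw [le_div_iff₀ ht]; linarith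
    calc _ ≤ (rowMatrix v fun k => x (f k)).det ^ 2 * (M / t) := by gcongr
      _ = M * ((rowMatrix v fun k => x (f k)).det ^ 2 / t) := by ring
      _ ≤ _ := le_add_of_nonneg_right (by positivity)
  · have ha : a ≠ 0 := by rintro rfl; simp at hc
    have h3 := exp_le_trace_exp (hS ▸ sumOuter_transpose v _ _) hθ ha (not_le.1 hc).le
    have h4 : 1 ≤ Real.exp (θ * t) * (NormedSpace.exp (-θ • S)).trace := by
      calc (1 : ℝ) = Real.exp (θ * t) * Real.exp (-θ * t) := by
            rw [← Real.exp_add]; simp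
        _ ≤ _ := by gcongr
    calc _ ≤ adjugateSq v (fun k => x (f k)) * ∑ k, (v (x (f k)) ⬝ᵥ a) ^ 2 := det_sq_mul_le _ _ _
      _ ≤ adjugateSq v (fun k => x (f k)) * (M * 1) := by gcongr; linarith
      _ ≤ adjugateSq v (fun k => x (f k)) *
          (M * (Real.exp (θ * t) * (NormedSpace.exp (-θ • S)).trace)) := by gcongr
      _ = M * (adjugateSq v (fun k => x (f k)) *
          (Real.exp (θ * t) * (NormedSpace.exp (-θ • S)).trace)) := by ring
      _ ≤ _ := le_add_of_nonneg_left (by positivity)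

theorem card_compl_range {n : ℕ} (f : Fin m ↪ Fin n) :
    (Fintype.card {i // i ∉ Set.range f} : ℝ) = n - m := by
  have h := Fintype.card_congr (sumComplRangeEquiv f)
  rw [Fintype.card_sum, Fintype.card_fin, Fintype.card_fin] at h
  have h' : (m : ℝ) + (Fintype.card {i // i ∉ Set.range f} : ℝ) = n := by exact_mod_cast h
  linarith

/-- The Gram determinant of the vectors `v(x_i)`. -/
noncomputable def gramDet (v : X → Fin m → ℝ) {n : ℕ} (x : Fin n → X) : ℝ :=
  ((Matrix.of fun i j => v (x i) j)ᵀ * Matrix.of fun i j => v (x i) j).det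

theorem factorial_mul_gramDet (v : X → Fin m → ℝ) {n : ℕ} (x : Fin n → X) :
    (m.factorial : ℝ) * gramDet v x
      = ∑ f : Fin m ↪ Fin n, (rowMatrix v fun k => x (f k)).det ^ 2 :=
  factorial_mul_det_transpose_mul_self _

theorem gramDet_nonneg (v : X → Fin m → ℝ) {n : ℕ} (x : Fin n → X) : 0 ≤ gramDet v x := by
  have h : (0 : ℝ) ≤ m.factorial * gramDet v x := by
    rw [factorial_mul_gramDet]
    exact Finset.sum_nonneg fun _ _ => sq_nonneg _
  exact nonneg_of_mul_nonneg_right h (by positivity)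

/-- The bound on the inverse of the Gram matrix of a volume sample. -/
noncomputable def sampleBound (v : X → Fin m → ℝ) {n : ℕ} (t θ : ℝ) (x : Fin n → X) : ℝ :=
  (∑ f : Fin m ↪ Fin n, selectionBound v t θ f x) / (m.factorial * gramDet v x)

theorem sampleBound_nonneg (v : X → Fin m → ℝ) {n : ℕ} {t : ℝ} (ht : 0 ≤ t) (θ : ℝ)
    (x : Fin n → X) : 0 ≤ sampleBound v t θ x :=
  div_nonneg (Finset.sum_nonneg fun f _ => selectionBound_nonneg v ht θ f x)
    (mul_nonneg (by positivity) (gramDet_nonneg v x))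

/-- The bounds for the individual selections are added; by Cauchy–Binet their weights det² sum to m!
times the Gram determinant. -/
theorem dotProduct_self_le_sampleBound (v : X → Fin m → ℝ) {n : ℕ} {t θ M : ℝ} (ht : 0 < t)
    (hθ : 0 ≤ θ) {x : Fin n → X} (hx : 0 < gramDet v x) (a : Fin m → ℝ)
    (hM : ∑ i, (v (x i) ⬝ᵥ a) ^ 2 ≤ M) : a ⬝ᵥ a ≤ M * sampleBound v t θ x := by
  rw [sampleBound, ← mul_div_assoc, le_div_iff₀ (by positivity), factorial_mul_gramDet,
    Finset.mul_sum, Finset.mul_sum]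
  refine Finset.sum_le_sum fun f _ => ?_
  rw [mul_comm]
  exact det_sq_mul_le_selectionBound v ht hθ f x a hM

variable [MeasurableSpace X]

theorem measurable_rowMatrix_apply {v : X → Fin m → ℝ} (hv : Measurable v) (j k : Fin m) :
    Measurable fun y : Fin m → X => rowMatrix v y j k := by
  simp only [rowMatrix, Matrix.of_apply]
  fun_prop

theorem measurable_det {Y : Type*} [MeasurableSpace Y] {A : Y → Matrix (Fin m) (Fin m) ℝ}
    (hA : ∀ j k, Measurable fun y => A y j k) : Measurable fun y => (A y).det := by
  simp only [Matrix.det_apply']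
  fun_prop

theorem measurable_adjugate {Y : Type*} [MeasurableSpace Y] {A : Y → Matrix (Fin m) (Fin m) ℝ}
    (hA : ∀ j k, Measurable fun y => A y j k) (i j : Fin m) :
    Measurable fun y => (A y).adjugate i j := by
  simp only [Matrix.adjugate_apply]
  refine measurable_det fun k l => ?_
  simp only [Matrix.updateRow_apply]
  split_ifs
  · exact measurable_const
  · exact hA k l

theorem measurable_adjugateSq {v : X → Fin m → ℝ} (hv : Measurable v) :
    Measurable (adjugateSq v) := by
  refine Finset.measurable_fun_sum _ fun j _ => Finset.measurable_fun_sum _ fun i _ => ?_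
  exact (measurable_adjugate (measurable_rowMatrix_apply hv) i j).pow_const 2

theorem lintegral_det_comp_embedding {ν : Measure X} [IsProbabilityMeasure ν]
    {v : X → Fin m → ℝ} (hv : IsIsotropic ν v) {n : ℕ} (f : Fin m ↪ Fin n) :
    ∫⁻ x : Fin n → X, ENNReal.ofReal ((rowMatrix v fun k => x (f k)).det ^ 2)
      ∂(Measure.pi fun _ => ν) = ENNReal.ofReal m.factorial := by
  have h := lintegral_comp_embedding_mul (ν := ν) f
    (F := fun y => ENNReal.ofReal ((rowMatrix v y).det ^ 2)) (G := fun _ => 1)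
    (((measurable_det (measurable_rowMatrix_apply hv.measurable)).pow_const 2).ennreal_ofReal)
    measurable_const
  simpa [lintegral_det_sq hv] using h

theorem measurable_selectionBound {v : X → Fin m → ℝ} (hv : Measurable v) {n : ℕ} (t θ : ℝ)
    (f : Fin m ↪ Fin n) : Measurable (selectionBound v t θ f) := by
  have hsel : Measurable fun x : Fin n → X => fun k => x (f k) := by fun_prop
  have hc : Measurable fun x : Fin n → X => fun i : {i // i ∉ Set.range f} => x i := by fun_prop
  refine Measurable.add ?_ (Measurable.mul ?_ (Measurable.mul measurable_const ?_))
  · exact (((measurable_det (measurable_rowMatrix_apply hv)).comp hsel).pow_const 2).div_const t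
  · exact (measurable_adjugateSq hv).comp hsel
  · refine (measurable_trace_exp fun j k => ?_)
    exact ((measurable_sumOuter_apply hv Finset.univ j k).comp hc).const_mul (-θ)

/-- The adjugate sees only the selected points and the trace exponential only the others, so the
integral of their product factors. One m in m² comes from the adjugate, the other from the trace. -/
theorem lintegral_selectionBound_le [NeZero m] {ν : Measure X} [IsProbabilityMeasure ν]
    {v : X → Fin m → ℝ} (hv : IsIsotropic ν v) {K : ℝ} (hK : ∀ x, v x ⬝ᵥ v x ≤ K) {n : ℕ}
    {t : ℝ} (ht : 0 < t) (θ : ℝ) (f : Fin m ↪ Fin n) :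
    ∫⁻ x : Fin n → X, ENNReal.ofReal (selectionBound v t θ f x) ∂(Measure.pi fun _ => ν)
      ≤ ENNReal.ofReal (m.factorial * (t⁻¹ + (m : ℝ) ^ 2 *
          Real.exp (θ * t - (1 - Real.exp (-θ * K)) / K * (n - m)))) := by
  have hdet : ∫⁻ x : Fin n → X, ENNReal.ofReal ((rowMatrix v fun k => x (f k)).det ^ 2 / t)
      ∂(Measure.pi fun _ => ν) = ENNReal.ofReal (m.factorial * t⁻¹) := by
    simp_rw [div_eq_mul_inv, fun x : Fin n → X => ENNReal.ofReal_mul (q := t⁻¹)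
      (sq_nonneg ((rowMatrix v fun k => x (f k)).det))]
    rw [lintegral_mul_const' _ _ ENNReal.ofReal_ne_top, lintegral_det_comp_embedding hv,
      ENNReal.ofReal_mul (by positivity)]
  have hadj : ∫⁻ x : Fin n → X, ENNReal.ofReal (adjugateSq v (fun k => x (f k)) *
      (Real.exp (θ * t) * (NormedSpace.exp (-θ • sumOuter v Finset.univ
        (fun i : {i // i ∉ Set.range f} => x i))).trace)) ∂(Measure.pi fun _ => ν)
      ≤ ENNReal.ofReal (m.factorial * ((m : ℝ) ^ 2 *
          Real.exp (θ * t - (1 - Real.exp (-θ * K)) / K * (n - m)))) := by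
    have hT := lintegral_trace_exp_neg_sumOuter_le hv θ hK {i // i ∉ Set.range f}
    rw [card_compl_range] at hT
    set T : ({i // i ∉ Set.range f} → X) → ℝ := fun z =>
      (NormedSpace.exp (-θ • sumOuter v Finset.univ z)).trace with hTdef
    have hTm : Measurable T := measurable_trace_exp fun j k =>
      (measurable_sumOuter_apply hv.measurable Finset.univ j k).const_mul (-θ)
    have h1 : ∫⁻ x : Fin n → X, ENNReal.ofReal (adjugateSq v (fun k => x (f k)) *
        (Real.exp (θ * t) * T fun i => x i)) ∂(Measure.pi fun _ => ν)
        = ∫⁻ x : Fin n → X, ENNReal.ofReal (adjugateSq v (fun k => x (f k))) *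
          ENNReal.ofReal (Real.exp (θ * t) * T fun i => x i) ∂(Measure.pi fun _ => ν) :=
      lintegral_congr fun x => ENNReal.ofReal_mul (adjugateSq_nonneg _ _)
    have h2 : ∫⁻ z, ENNReal.ofReal (Real.exp (θ * t) * T z) ∂(Measure.pi fun _ => ν)
        = ENNReal.ofReal (Real.exp (θ * t)) *
          ∫⁻ z, ENNReal.ofReal (T z) ∂(Measure.pi fun _ => ν) := by
      rw [← lintegral_const_mul' _ _ ENNReal.ofReal_ne_top]
      exact lintegral_congr fun z => ENNReal.ofReal_mul (Real.exp_pos _).le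
    refine h1.le.trans ?_
    rw [lintegral_comp_embedding_mul f (F := fun y => ENNReal.ofReal (adjugateSq v y))
      (G := fun z => ENNReal.ofReal (Real.exp (θ * t) * T z))
      (measurable_adjugateSq hv.measurable).ennreal_ofReal (hTm.const_mul _).ennreal_ofReal,
      lintegral_adjugateSq hv, h2]
    calc _ ≤ ENNReal.ofReal (m * m.factorial) * (ENNReal.ofReal (Real.exp (θ * t)) *
          ENNReal.ofReal (m * Real.exp (-((1 - Real.exp (-θ * K)) / K) * (n - m)))) := by
          gcongr
      _ = _ := by
          rw [← ENNReal.ofReal_mul (by positivity), ← ENNReal.ofReal_mul (by positivity)]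
          congr 1
          rw [sub_eq_add_neg (θ * t), Real.exp_add, neg_mul]
          ring
  calc _ = ∫⁻ x : Fin n → X, (ENNReal.ofReal ((rowMatrix v fun k => x (f k)).det ^ 2 / t)
        + ENNReal.ofReal (adjugateSq v (fun k => x (f k)) *
      (Real.exp (θ * t) * (NormedSpace.exp (-θ • sumOuter v Finset.univ
        (fun i : {i // i ∉ Set.range f} => x i))).trace))) ∂(Measure.pi fun _ => ν) := by
        refine lintegral_congr fun x => ?_
        rw [← ENNReal.ofReal_add (by positivity) (mul_nonneg (adjugateSq_nonneg _ _)
          (mul_nonneg (Real.exp_pos _).le (trace_exp_sumOuter_nonneg _ _ _ _)))]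
        rfl
    _ ≤ _ := by
        rw [lintegral_add_left, hdet, mul_add, ENNReal.ofReal_add (by positivity) (by positivity)]
        · gcongr
        · have hsel : Measurable fun x : Fin n → X => fun k => x (f k) := by fun_prop
          exact ((((measurable_det (measurable_rowMatrix_apply hv.measurable)).comp
            hsel).pow_const 2).div_const t).ennreal_ofReal

theorem card_embedding_mul {n : ℕ} (hmn : m ≤ n) :
    ((n - m).factorial : ℝ) / n.factorial * (Fintype.card (Fin m ↪ Fin n) : ℝ) = 1 := by
  rw [Fintype.card_embedding_eq, Fintype.card_fin, Fintype.card_fin,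
    div_mul_eq_mul_div, div_eq_one_iff_eq (by positivity)]
  exact_mod_cast Nat.factorial_mul_descFactorial hmn

theorem measurable_gramDet {v : X → Fin m → ℝ} (hv : Measurable v) {n : ℕ} :
    Measurable fun x : Fin n → X => gramDet v x := by
  refine measurable_det fun j k => ?_
  simp only [Matrix.mul_apply, Matrix.transpose_apply, Matrix.of_apply]
  fun_prop

/-- Volume sampling for the vectors `v` and the measure `ν`. -/
noncomputable def gramSampling (ν : Measure X) (v : X → Fin m → ℝ) (n : ℕ) :
    Measure (Fin n → X) :=
  (Measure.pi fun _ : Fin n => ν).withDensity fun x =>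
    ENNReal.ofReal (((n - m).factorial : ℝ) / (n.factorial : ℝ) * gramDet v x)

theorem measurable_gramSampling_density {v : X → Fin m → ℝ} (hv : Measurable v) (n : ℕ) :
    Measurable fun x : Fin n → X =>
      ENNReal.ofReal (((n - m).factorial : ℝ) / (n.factorial : ℝ) * gramDet v x) :=
  ((measurable_gramDet hv).const_mul _).ennreal_ofReal

/-- Each of the n!/(n-m)! injections contributes m! to the integral of m! times the Gram
determinant. -/
theorem isProbabilityMeasure_gramSampling {ν : Measure X} [IsProbabilityMeasure ν]
    {v : X → Fin m → ℝ} (hv : IsIsotropic ν v) {n : ℕ} (hmn : m ≤ n) :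
    IsProbabilityMeasure (gramSampling ν v n) := by
  refine ⟨?_⟩
  rw [gramSampling, withDensity_apply _ MeasurableSet.univ, Measure.restrict_univ]
  set c : ℝ := ((n - m).factorial : ℝ) / (n.factorial : ℝ) with hc
  have hc0 : 0 ≤ c := by positivity
  have e : ∀ x : Fin n → X, ENNReal.ofReal (c * gramDet v x) = ENNReal.ofReal (c / m.factorial)
      * ∑ f : Fin m ↪ Fin n, ENNReal.ofReal ((rowMatrix v fun k => x (f k)).det ^ 2) := fun x => by
    rw [← ENNReal.ofReal_sum_of_nonneg fun f _ => sq_nonneg _, ← factorial_mul_gramDet,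
      ← ENNReal.ofReal_mul (by positivity)]
    congr 1
    field_simp
  simp_rw [e]
  rw [lintegral_const_mul' _ _ ENNReal.ofReal_ne_top, lintegral_finsetSum]
  · simp_rw [lintegral_det_comp_embedding hv]
    rw [Finset.sum_const, nsmul_eq_mul, ← ENNReal.ofReal_natCast,
      ← ENNReal.ofReal_mul (by positivity), ← ENNReal.ofReal_mul (by positivity),
      ← ENNReal.ofReal_one]
    congr 1
    rw [Finset.card_univ, ← card_embedding_mul hmn, ← hc]
    field_simp
  · intro f _
    have hsel : Measurable fun x : Fin n → X => fun k => x (f k) := by fun_prop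
    exact (((measurable_det (measurable_rowMatrix_apply hv.measurable)).comp
      hsel).pow_const 2).ennreal_ofReal

theorem ae_gramDet_pos {ν : Measure X} [IsProbabilityMeasure ν] {v : X → Fin m → ℝ}
    (hv : Measurable v) (n : ℕ) : ∀ᵐ x ∂gramSampling ν v n, 0 < gramDet v x := by
  rw [gramSampling, ae_withDensity_iff (measurable_gramSampling_density hv n)]
  refine Eventually.of_forall fun x hx => ?_
  refine lt_of_le_of_ne (gramDet_nonneg v x) fun h => hx ?_
  rw [← h, mul_zero, ENNReal.ofReal_zero]

theorem measurable_sampleBound {v : X → Fin m → ℝ} (hv : Measurable v) {n : ℕ} (t θ : ℝ) :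
    Measurable fun x : Fin n → X => sampleBound v t θ x :=
  (Finset.measurable_fun_sum _ fun f _ => measurable_selectionBound hv t θ f).div
    ((measurable_gramDet hv).const_mul _)

/-- The density cancels the Gram determinant in the denominator of `sampleBound`, leaving an average
over the selections of integrals against ν^{⊗n}. -/
theorem lintegral_sampleBound_le [NeZero m] {ν : Measure X} [IsProbabilityMeasure ν]
    {v : X → Fin m → ℝ} (hv : IsIsotropic ν v) {K : ℝ} (hK : ∀ x, v x ⬝ᵥ v x ≤ K) {n : ℕ}
    (hmn : m ≤ n) {t : ℝ} (ht : 0 < t) (θ : ℝ) :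
    ∫⁻ x, ENNReal.ofReal (sampleBound v t θ x) ∂(gramSampling ν v n)
      ≤ ENNReal.ofReal (t⁻¹ + (m : ℝ) ^ 2 *
          Real.exp (θ * t - (1 - Real.exp (-θ * K)) / K * (n - m))) := by
  set B := t⁻¹ + (m : ℝ) ^ 2 * Real.exp (θ * t - (1 - Real.exp (-θ * K)) / K * (n - m)) with hB
  set c : ℝ := ((n - m).factorial : ℝ) / (n.factorial : ℝ) with hc
  have hB0 : 0 ≤ B := by positivity
  have hc0 : 0 ≤ c := by positivity
  rw [gramSampling, lintegral_withDensity_eq_lintegral_mul _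
    (measurable_gramSampling_density hv.measurable n)
    (measurable_sampleBound hv.measurable t θ).ennreal_ofReal]
  calc _ ≤ ∫⁻ x : Fin n → X, ENNReal.ofReal (c / m.factorial) *
        ∑ f : Fin m ↪ Fin n, ENNReal.ofReal (selectionBound v t θ f x)
          ∂(Measure.pi fun _ => ν) := by
        refine lintegral_mono fun x => ?_
        rw [Pi.mul_apply, ← ENNReal.ofReal_mul (mul_nonneg hc0 (gramDet_nonneg v x)),
          ← ENNReal.ofReal_sum_of_nonneg fun f _ => selectionBound_nonneg v ht.le θ f x,
          ← ENNReal.ofReal_mul (by positivity)]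
        refine ENNReal.ofReal_le_ofReal ?_
        have hs : 0 ≤ ∑ f : Fin m ↪ Fin n, selectionBound v t θ f x :=
          Finset.sum_nonneg fun f _ => selectionBound_nonneg v ht.le θ f x
        rcases (gramDet_nonneg v x).eq_or_lt with h | h
        · rw [← h, mul_zero, zero_mul]
          positivity
        · refine le_of_eq ?_
          rw [sampleBound]
          field_simp
    _ ≤ ENNReal.ofReal (c / m.factorial) *
        ∑ f : Fin m ↪ Fin n, ENNReal.ofReal (m.factorial * B) := by
        rw [lintegral_const_mul' _ _ ENNReal.ofReal_ne_top, lintegral_finsetSum]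
        · gcongr
          exact lintegral_selectionBound_le hv hK ht θ _
        · exact fun f _ => (measurable_selectionBound hv.measurable t θ f).ennreal_ofReal
    _ = ENNReal.ofReal B := by
        rw [Finset.sum_const, nsmul_eq_mul, ← ENNReal.ofReal_natCast,
          ← ENNReal.ofReal_mul (by positivity), ← ENNReal.ofReal_mul (by positivity)]
        congr 1
        have h := card_embedding_mul hmn
        rw [← hc] at h
        rw [Finset.card_univ]
        calc _ = (c * (Fintype.card (Fin m ↪ Fin n) : ℝ)) * B := by field_simp
          _ = B := by rw [h, one_mul]

end VolumeSampling

/-! ### Orthonormal expansions in L². -/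

section L2

variable {X : Type*} {m : ℕ} {φ : Fin m → X → ℝ}

/-- The function of the approximation space with coefficients `a`. -/
def combination (φ : Fin m → X → ℝ) (a : Fin m → ℝ) : X → ℝ := fun x => ∑ j, a j * φ j x

theorem mem_approxSpace_iff {g : X → ℝ} :
    g ∈ approxSpace φ ↔ ∃ a, g = combination φ a := by
  rw [approxSpace, Submodule.mem_span_range_iff_exists_fun]
  refine exists_congr fun a => ?_
  have e : ∑ i, a i • φ i = combination φ a := by
    ext x; simp [combination]
  rw [e, eq_comm]

variable [MeasurableSpace X] {μ : Measure X}

theorem l2norm_sq {g : X → ℝ} (hg : MemLp g 2 μ) : l2norm μ g ^ 2 = ∫ x, g x ^ 2 ∂μ := by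
  have h := hg.eLpNorm_eq_integral_rpow_norm two_ne_zero ENNReal.ofNat_ne_top
  have h0 : 0 ≤ ∫ x, g x ^ 2 ∂μ := integral_nonneg fun x => sq_nonneg _
  simp only [ENNReal.toReal_ofNat, Real.rpow_two, Real.norm_eq_abs, sq_abs] at h
  rw [l2norm, h, ENNReal.toReal_ofReal (by positivity), ← Real.rpow_natCast, ← Real.rpow_mul h0]
  norm_num

theorem l2norm_nonneg (μ : Measure X) (g : X → ℝ) : 0 ≤ l2norm μ g := ENNReal.toReal_nonneg

theorem l2norm_sub_le {f g p : X → ℝ} (h1 : MemLp (f - g) 2 μ) (h2 : MemLp (p - g) 2 μ) :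
    l2norm μ (f - p) ≤ l2norm μ (f - g) + l2norm μ (p - g) := by
  have h := eLpNorm_sub_le h1.aestronglyMeasurable h2.aestronglyMeasurable
    (show (1 : ℝ≥0∞) ≤ 2 by norm_num)
  rw [sub_sub_sub_cancel_right] at h
  rw [l2norm, l2norm, l2norm, ← ENNReal.toReal_add h1.eLpNorm_ne_top h2.eLpNorm_ne_top]
  exact ENNReal.toReal_mono (ENNReal.add_ne_top.2 ⟨h1.eLpNorm_ne_top, h2.eLpNorm_ne_top⟩) h

theorem memLp_combination (hφ : IsONSystem μ φ) (a : Fin m → ℝ) :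
    MemLp (combination φ a) 2 μ :=
  memLp_finsetSum _ fun j _ => (hφ.memLp j).const_mul (a j)

theorem integrable_mul_of_isONSystem (hφ : IsONSystem μ φ) (i j : Fin m) :
    Integrable (fun x => φ i x * φ j x) μ := (hφ.memLp i).integrable_mul (hφ.memLp j)

/-- It makes the squared error a polynomial in the coefficients, which reduces its measurability in
the sample to theirs. The case f = 0 is Parseval. -/
theorem integral_sub_combination_sq (hφ : IsONSystem μ φ) {f : X → ℝ} (hf : MemLp f 2 μ)
    (a : Fin m → ℝ) : l2norm μ (f - combination φ a) ^ 2
      = ∫ x, f x ^ 2 ∂μ - 2 * ∑ j, a j * ∫ x, f x * φ j x ∂μ + a ⬝ᵥ a := by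
  have h1 : Integrable (fun x => f x ^ 2) μ := hf.integrable_sq
  have h2 : ∀ j, Integrable (fun x => a j * (f x * φ j x)) μ := fun j =>
    (hf.integrable_mul (hφ.memLp j)).const_mul _
  have h3 : ∀ i j, Integrable (fun x => a i * a j * (φ i x * φ j x)) μ := fun i j =>
    (integrable_mul_of_isONSystem hφ i j).const_mul _
  rw [l2norm_sq (hf.sub (memLp_combination hφ a))]
  have e : ∀ x, (f - combination φ a) x ^ 2 = f x ^ 2 - 2 * ∑ j, a j * (f x * φ j x)
      + ∑ i, ∑ j, a i * a j * (φ i x * φ j x) := fun x => by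
    have e1 : ∑ j, a j * (f x * φ j x) = f x * combination φ a x := by
      rw [combination, Finset.mul_sum]; exact Finset.sum_congr rfl fun j _ => by ring
    have e2 : ∑ i, ∑ j, a i * a j * (φ i x * φ j x) = combination φ a x ^ 2 := by
      rw [combination, pow_two, Finset.sum_mul_sum]
      exact Finset.sum_congr rfl fun i _ => Finset.sum_congr rfl fun j _ => by ring
    rw [e1, e2, Pi.sub_apply]; ring
  simp only [e]
  rw [integral_add, integral_sub h1, integral_const_mul, integral_finsetSum _ fun j _ => h2 j,
    integral_finsetSum _ fun i _ => integrable_finsetSum _ fun j _ => h3 i j]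
  · simp_rw [integral_finsetSum _ fun j _ => h3 _ j, integral_const_mul, hφ.orthonormal]
    simp [dotProduct]
  · exact (integrable_finsetSum _ fun j _ => h2 j).const_mul 2
  · exact h1.sub ((integrable_finsetSum _ fun j _ => h2 j).const_mul 2)
  · exact integrable_finsetSum _ fun i _ => integrable_finsetSum _ fun j _ => h3 i j

theorem l2norm_combination_sq (hφ : IsONSystem μ φ) (a : Fin m → ℝ) :
    l2norm μ (combination φ a) ^ 2 = a ⬝ᵥ a := by
  have h := integral_sub_combination_sq hφ (f := 0) MemLp.zero' (-a)
  have e : (0 : X → ℝ) - combination φ (-a) = combination φ a := by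
    ext x; simp [combination]
  rw [e] at h
  simpa using h

end L2

/-! ### The mixture weight and the weighted features. -/

section Weights

variable {X : Type*} {m : ℕ}

/-- The weighted features `w^{-1/2} φ`. -/
noncomputable def weightedFeature (φ : Fin m → X → ℝ) (w : X → ℝ) (x : X) : Fin m → ℝ :=
  fun j => (√(w x))⁻¹ * φ j x

theorem weightedFeature_mul {φ : Fin m → X → ℝ} {w : X → ℝ} {x : X} (hw : 0 < w x)
    (j k : Fin m) : weightedFeature φ w x j * weightedFeature φ w x k
      = (w x)⁻¹ * (φ j x * φ k x) := by
  have h : (√(w x))⁻¹ * (√(w x))⁻¹ = (w x)⁻¹ := by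
    rw [← mul_inv, Real.mul_self_sqrt hw.le]
  rw [weightedFeature, weightedFeature, ← h]; ring

theorem weightedFeature_dotProduct_sq {φ : Fin m → X → ℝ} {w : X → ℝ} {x : X} (hw : 0 < w x)
    (a : Fin m → ℝ) :
    (weightedFeature φ w x ⬝ᵥ a) ^ 2 = (w x)⁻¹ * combination φ a x ^ 2 := by
  have h : weightedFeature φ w x ⬝ᵥ a = (√(w x))⁻¹ * combination φ a x := by
    rw [dotProduct, combination, Finset.mul_sum]
    exact Finset.sum_congr rfl fun j _ => by rw [weightedFeature]; ring
  rw [h, mul_pow, inv_pow, Real.sq_sqrt hw.le]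

theorem christoffelWeight_nonneg (φ : Fin m → X → ℝ) (x : X) : 0 ≤ christoffelWeight φ x :=
  mul_nonneg (by positivity) (Finset.sum_nonneg fun _ _ => sq_nonneg _)

/-- Here |v|² = m w_m/w, and the Christoffel part of the mixture caps this ratio; this supplies the
constant K of the Chernoff bound. -/
theorem weightedFeature_dotProduct_self_le (hm : 1 ≤ m) {φ : Fin m → X → ℝ} {w : X → ℝ} {α : ℝ}
    (hα : 0 < α) {x : X} (hw : 0 < w x) (h : α * christoffelWeight φ x ≤ w x) :
    weightedFeature φ w x ⬝ᵥ weightedFeature φ w x ≤ m / α := by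
  have e : weightedFeature φ w x ⬝ᵥ weightedFeature φ w x = (w x)⁻¹ * ∑ j, φ j x ^ 2 := by
    rw [dotProduct, Finset.mul_sum]
    exact Finset.sum_congr rfl fun j _ => by rw [weightedFeature_mul hw, pow_two]
  have hm' : (0 : ℝ) < m := by exact_mod_cast hm
  rw [e, inv_mul_le_iff₀ hw, mul_div_assoc', le_div_iff₀ hα]
  rw [christoffelWeight] at h
  calc (∑ j, φ j x ^ 2) * α = (α * (1 / (m : ℝ) * ∑ j, φ j x ^ 2)) * m := by field_simp
    _ ≤ _ := by gcongr

variable [MeasurableSpace X] {μ : Measure X}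

theorem measurable_weightedFeature {φ : Fin m → X → ℝ} {w : X → ℝ} (hφ : ∀ j, Measurable (φ j))
    (hw : Measurable w) : Measurable (weightedFeature φ w) := by
  refine measurable_pi_lambda _ fun j => ?_
  have := hφ j
  simp only [weightedFeature]
  fun_prop

/-- The factor w⁻¹ in v vᵀ cancels the density of ν, leaving orthonormality under μ. -/
theorem isIsotropic_weightedFeature {φ : Fin m → X → ℝ} {w : X → ℝ} (hφ : IsONSystem μ φ)
    (hw : Measurable w) (hw0 : ∀ x, 0 < w x) :
    IsIsotropic (weightedMeasure μ w) (weightedFeature φ w) := by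
  have e : ∀ j k x, (w x).toNNReal • (weightedFeature φ w x j * weightedFeature φ w x k)
      = φ j x * φ k x := fun j k x => by
    rw [weightedFeature_mul (hw0 x), NNReal.smul_def, Real.coe_toNNReal _ (hw0 x).le, smul_eq_mul,
      mul_inv_cancel_left₀ (hw0 x).ne']
  refine ⟨measurable_weightedFeature hφ.measurable hw, fun j k => ?_, fun j k => ?_⟩
  · refine (integrable_withDensity_iff_integrable_smul hw.real_toNNReal).2 ?_
    simp only [e]
    exact integrable_mul_of_isONSystem hφ j k
  · refine (integral_withDensity_eq_integral_smul hw.real_toNNReal _).trans ?_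
    simp only [e]
    exact hφ.orthonormal j k

theorem measurable_christoffelWeight {φ : Fin m → X → ℝ} (hφ : ∀ j, Measurable (φ j)) :
    Measurable (christoffelWeight φ) := by
  unfold christoffelWeight
  fun_prop

theorem lintegral_christoffelWeight (hm : 1 ≤ m) {φ : Fin m → X → ℝ} (hφ : IsONSystem μ φ) :
    ∫⁻ x, ENNReal.ofReal (christoffelWeight φ x) ∂μ = 1 := by
  have hi : ∀ j, Integrable (fun x => φ j x ^ 2) μ := fun j => (hφ.memLp j).integrable_sq
  have hs : ∫ x, christoffelWeight φ x ∂μ = 1 := by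
    simp only [christoffelWeight]
    rw [integral_const_mul, integral_finsetSum _ fun j _ => hi j]
    have : ∀ j, ∫ x, φ j x ^ 2 ∂μ = 1 := fun j => by
      simpa [pow_two] using hφ.orthonormal j j
    have hm' : (m : ℝ) ≠ 0 := by positivity
    simp [this, hm']
  have hI : Integrable (christoffelWeight φ) μ :=
    (integrable_finsetSum _ fun j _ => hi j).const_mul _
  rw [← ofReal_integral_eq_lintegral_ofReal hI
    (Eventually.of_forall (christoffelWeight_nonneg φ)), hs, ENNReal.ofReal_one]

theorem measurable_mixtureWeight {φ : Fin m → X → ℝ} (hφ : ∀ j, Measurable (φ j)) {h : X → ℝ}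
    (hh : Measurable h) (α : ℝ) : Measurable (mixtureWeight φ h α) :=
  ((measurable_christoffelWeight hφ).const_mul α).add (hh.const_mul (1 - α))

theorem isProbabilityMeasure_weightedMeasure (hm : 1 ≤ m) {φ : Fin m → X → ℝ}
    (hφ : IsONSystem μ φ) {h : X → ℝ} (hh : IsPosDensity μ h) {α : ℝ} (hα0 : 0 ≤ α)
    (hα1 : α < 1) : IsProbabilityMeasure (weightedMeasure μ (mixtureWeight φ h α)) := by
  refine ⟨?_⟩
  have h1 : 0 ≤ 1 - α := by linarith
  rw [weightedMeasure, withDensity_apply _ MeasurableSet.univ, Measure.restrict_univ]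
  have e : ∀ x, ENNReal.ofReal (mixtureWeight φ h α x)
      = ENNReal.ofReal α * ENNReal.ofReal (christoffelWeight φ x)
        + ENNReal.ofReal (1 - α) * ENNReal.ofReal (h x) := fun x => by
    rw [mixtureWeight, ENNReal.ofReal_add (mul_nonneg hα0 (christoffelWeight_nonneg φ x))
      (mul_nonneg h1 (hh.pos x).le), ENNReal.ofReal_mul hα0, ENNReal.ofReal_mul h1]
  simp only [e]
  rw [lintegral_add_left ((measurable_christoffelWeight hφ.measurable).ennreal_ofReal.const_mul _),
    lintegral_const_mul' _ _ ENNReal.ofReal_ne_top, lintegral_const_mul' _ _ ENNReal.ofReal_ne_top,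
    lintegral_christoffelWeight hm hφ, hh.lintegral_eq_one, mul_one, mul_one,
    ← ENNReal.ofReal_add hα0 h1]
  simp

/-- Almost sure properties of a point hold for all the points of a repeated volume sample. -/
theorem ae_repeatedVolumeSampling {φ : Fin m → X → ℝ} {w : X → ℝ} {n r : ℕ}
    [SigmaFinite (weightedMeasure μ w)] [SigmaFinite (volumeSampling μ φ w n)] {p : X → Prop}
    (hp : ∀ᵐ y ∂μ, p y) :
    ∀ᵐ x ∂(repeatedVolumeSampling μ φ w n r), ∀ k i, p (x k i) := by
  have h1 : ∀ᵐ y ∂(weightedMeasure μ w), p y := (withDensity_absolutelyContinuous μ _).ae_le hp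
  have h2 : ∀ᵐ x ∂(volumeSampling μ φ w n), ∀ i, p (x i) := by
    refine (withDensity_absolutelyContinuous _ _).ae_le ?_
    exact ae_all_iff.2 fun i =>
      (Measure.quasiMeasurePreserving_eval (μ := fun _ : Fin n => weightedMeasure μ w) i).ae h1
  exact ae_all_iff.2 fun k =>
    (Measure.quasiMeasurePreserving_eval (μ := fun _ : Fin r => volumeSampling μ φ w n) k).ae h2

end Weights

/-! ### Normal equations and empirical norms. -/

section LeastSquares

variable {X ι : Type*} [Fintype ι] {m : ℕ}

theorem IsLeastSquares.orthogonal [Nonempty ι] {φ : Fin m → X → ℝ} {w f p : X → ℝ} {x : ι → X}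
    (h : IsLeastSquares φ w f x p) {d : X → ℝ} (hd : d ∈ approxSpace φ) :
    ∑ i, (w (x i))⁻¹ * ((f (x i) - p (x i)) * d (x i)) = 0 := by
  set b := ∑ i, (w (x i))⁻¹ * ((f (x i) - p (x i)) * d (x i)) with hb
  set D := ∑ i, (w (x i))⁻¹ * d (x i) ^ 2 with hD
  have hc : (0 : ℝ) < 1 / (Fintype.card ι : ℝ) := by
    have := Fintype.card_pos (α := ι)
    positivity
  have key : ∀ s : ℝ, 0 ≤ -2 * s * b + s ^ 2 * D := fun s => by
    have h1 := h.2 (Submodule.add_mem _ h.1 (Submodule.smul_mem _ s hd))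
    have h2 := le_of_mul_le_mul_left h1 hc
    have e : ∑ i, (w (x i))⁻¹ * (f (x i) - (p + s • d) (x i)) ^ 2
        = ∑ i, (w (x i))⁻¹ * (f (x i) - p (x i)) ^ 2 + (-2 * s * b + s ^ 2 * D) := by
      rw [hb, hD, Finset.mul_sum, Finset.mul_sum, ← Finset.sum_add_distrib,
        ← Finset.sum_add_distrib]
      refine Finset.sum_congr rfl fun i _ => ?_
      simp only [Pi.add_apply, Pi.smul_apply, smul_eq_mul]
      ring
    rw [e] at h2
    linarith
  by_contra hb0
  -- A small step along d contradicts minimality if b ≠ 0; |D| + 1 is positive whatever the sign of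
  -- D, since the weights are arbitrary here.
  have h3 := key (b / (|D| + 1))
  have hpos : 0 < |D| + 1 := by positivity
  have e : -2 * (b / (|D| + 1)) * b + (b / (|D| + 1)) ^ 2 * D
      = b ^ 2 * (D - 2 * (|D| + 1)) / (|D| + 1) ^ 2 := by field_simp; ring
  rw [e] at h3
  have h4 : b ^ 2 * (D - 2 * (|D| + 1)) / (|D| + 1) ^ 2 < 0 := by
    refine div_neg_of_neg_of_pos (mul_neg_of_pos_of_neg (by positivity) ?_) (by positivity)
    linarith [le_abs_self D, abs_nonneg D]
  linarith

/-- Pythagoras for the empirical inner product. -/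
theorem IsLeastSquares.sum_sq_le [Nonempty ι] {φ : Fin m → X → ℝ} {w f p g : X → ℝ} {x : ι → X}
    (h : IsLeastSquares φ w f x p) (hw : ∀ i, 0 < w (x i)) (hg : g ∈ approxSpace φ) :
    ∑ i, (w (x i))⁻¹ * (p - g) (x i) ^ 2 ≤ ∑ i, (w (x i))⁻¹ * (f (x i) - g (x i)) ^ 2 := by
  have h1 := h.orthogonal (Submodule.sub_mem _ h.1 hg)
  have e : ∑ i, (w (x i))⁻¹ * (f (x i) - g (x i)) ^ 2
      = ∑ i, (w (x i))⁻¹ * (f (x i) - p (x i)) ^ 2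
        + 2 * ∑ i, (w (x i))⁻¹ * ((f (x i) - p (x i)) * (p - g) (x i))
        + ∑ i, (w (x i))⁻¹ * (p - g) (x i) ^ 2 := by
    rw [Finset.mul_sum, ← Finset.sum_add_distrib, ← Finset.sum_add_distrib]
    refine Finset.sum_congr rfl fun i _ => ?_
    simp only [Pi.sub_apply]
    ring
  rw [e, h1]
  have : 0 ≤ ∑ i, (w (x i))⁻¹ * (f (x i) - p (x i)) ^ 2 :=
    Finset.sum_nonneg fun i _ => mul_nonneg (inv_nonneg.2 (hw i).le) (sq_nonneg _)
  linarith

/-- The normal equations. -/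
theorem IsLeastSquares.sumOuter_mulVec [Nonempty ι] {φ : Fin m → X → ℝ} {w f : X → ℝ}
    {x : ι → X} {a : Fin m → ℝ} (h : IsLeastSquares φ w f x (combination φ a))
    (hw : ∀ i, 0 < w (x i)) :
    sumOuter (weightedFeature φ w) Finset.univ x *ᵥ a
      = fun j => ∑ i, (w (x i))⁻¹ * (f (x i) * φ j (x i)) := by
  funext j
  have h1 := h.orthogonal (Submodule.subset_span (Set.mem_range_self j))
  rw [sumOuter, Matrix.sum_mulVec, Finset.sum_apply]
  have e : ∀ i, (vecMulVec (weightedFeature φ w (x i)) (weightedFeature φ w (x i)) *ᵥ a) j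
      = (w (x i))⁻¹ * (combination φ a (x i) * φ j (x i)) := fun i => by
    simp only [Matrix.mulVec, dotProduct, Matrix.vecMulVec_apply, weightedFeature_mul (hw i)]
    rw [combination, Finset.sum_mul, Finset.mul_sum]
    exact Finset.sum_congr rfl fun k _ => by ring
  simp only [e]
  rw [eq_comm, ← sub_eq_zero, ← Finset.sum_sub_distrib, ← h1]
  exact Finset.sum_congr rfl fun i _ => by ring

theorem card_mul_dotProduct_gram {φ : Fin m → X → ℝ} {w : X → ℝ} {x : ι → X} [Nonempty ι]
    (hw : ∀ i, 0 < w (x i)) (a : Fin m → ℝ) :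
    Fintype.card ι * (a ⬝ᵥ gram φ w x *ᵥ a) = ∑ i, (weightedFeature φ w (x i) ⬝ᵥ a) ^ 2 := by
  have hc : (Fintype.card ι : ℝ) ≠ 0 := by
    have := Fintype.card_pos (α := ι)
    positivity
  have e : (Fintype.card ι : ℝ) • gram φ w x = sumOuter (weightedFeature φ w) Finset.univ x := by
    ext j k
    simp only [gram, sumOuter, Matrix.smul_apply, Matrix.of_apply, Matrix.sum_apply,
      Matrix.vecMulVec_apply, weightedFeature_mul (hw _), smul_eq_mul]
    field_simp
  rw [← dotProduct_sumOuter, ← e, Matrix.smul_mulVec, dotProduct_smul, smul_eq_mul]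

theorem mul_dotProduct_self_le_of_le_lambdaMin {A : Matrix (Fin m) (Fin m) ℝ} (hA : Aᵀ = A)
    {t : ℝ} (ht : t ≤ lambdaMin A) (a : Fin m → ℝ) : t * (a ⬝ᵥ a) ≤ a ⬝ᵥ A *ᵥ a := by
  obtain ⟨U, d, -, hU', hAd, hs⟩ := exists_orthogonal_diagonalization hA
  have hd := (hs t).2 fun s hs => ht.trans (csInf_le (Matrix.finite_real_spectrum).bddBelow hs)
  rw [hAd, dotProduct_diagonal_conj, dotProduct_self_eq_sum hU', Finset.mul_sum]
  exact Finset.sum_le_sum fun i _ => mul_le_mul_of_nonneg_right (hd i) (sq_nonneg _)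

theorem gram_transpose (φ : Fin m → X → ℝ) (w : X → ℝ) (x : ι → X) :
    (gram φ w x)ᵀ = gram φ w x := by
  ext j k
  simp only [gram, Matrix.transpose_apply, Matrix.of_apply, mul_comm (φ k _)]

end LeastSquares

/-! ### Choice of the Chernoff parameters. -/

section Tail

theorem cδ_pos {δ : ℝ} (hδ0 : 0 < δ) (hδ1 : δ < 1) : 0 < cδ δ := by
  have h1 : 0 < 1 - δ := by linarith
  have h := Real.log_lt_sub_one_of_pos (inv_pos.2 h1) (by
    intro h
    rw [inv_eq_one] at h
    linarith)
  rw [Real.log_inv] at h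
  have h2 := mul_lt_mul_of_pos_left h h1
  rw [mul_sub, mul_inv_cancel₀ h1.ne'] at h2
  rw [cδ]
  linarith

/-- With K = m/α, θ = -log(1-δ)/K and t = (1-δ)(n-m) the exponent is -c_δ α(n-m)/m, at most -log(n r
m²) by hypothesis. This gives 1/(nr), of which only 1/n is kept. -/
theorem chernoff_tail_le {m n r : ℕ} (hm : 1 ≤ m) (hmn : m < n) (hr : 1 ≤ r) {δ α : ℝ}
    (hδ0 : 0 < δ) (hδ1 : δ < 1) (hα : 0 < α)
    (h : (m : ℝ) + (cδ δ)⁻¹ * α⁻¹ * m * Real.log (((n * r : ℕ) : ℝ) * (m : ℝ) ^ 2) ≤ n) :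
    (m : ℝ) ^ 2 * Real.exp (-Real.log (1 - δ) / (m / α) * ((1 - δ) * (n - m))
      - (1 - Real.exp (-(-Real.log (1 - δ) / (m / α)) * (m / α))) / (m / α) * (n - m))
      ≤ (n : ℝ)⁻¹ := by
  have hm' : (0 : ℝ) < m := by exact_mod_cast hm
  have hn' : (0 : ℝ) < n := by exact_mod_cast hm.trans_lt hmn |>.trans_le' (Nat.zero_le 1)
  have hr' : (1 : ℝ) ≤ r := by exact_mod_cast hr
  have h1 : 0 < 1 - δ := by linarith
  have hc := cδ_pos hδ0 hδ1
  have hK : (0 : ℝ) < m / α := by positivity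
  have e1 : Real.exp (-(-Real.log (1 - δ) / (m / α)) * (m / α)) = 1 - δ := by
    rw [neg_mul, div_mul_cancel₀ _ hK.ne', neg_neg, Real.exp_log h1]
  have e2 : -Real.log (1 - δ) / (m / α) * ((1 - δ) * (n - m)) - (1 - (1 - δ)) / (m / α) * (n - m)
      = -(cδ δ * α * (n - m) / m) := by
    rw [cδ]; field_simp; ring
  set L := Real.log (((n * r : ℕ) : ℝ) * (m : ℝ) ^ 2) with hL
  have hpos : (0 : ℝ) < ((n * r : ℕ) : ℝ) * (m : ℝ) ^ 2 := by push_cast; positivity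
  have h3 : L ≤ cδ δ * α * (n - m) / m := by
    rw [le_div_iff₀ hm']
    have h4 : (cδ δ)⁻¹ * α⁻¹ * m * L ≤ n - m := by linarith
    calc L * m = (cδ δ * α) * ((cδ δ)⁻¹ * α⁻¹ * m * L) := by field_simp
      _ ≤ _ := by gcongr
  rw [e1, e2]
  calc (m : ℝ) ^ 2 * Real.exp (-(cδ δ * α * (n - m) / m)) ≤ (m : ℝ) ^ 2 * Real.exp (-L) := by
        gcongr
    _ = (n * r : ℝ)⁻¹ := by
        rw [Real.exp_neg, hL, Real.exp_log hpos]; push_cast; field_simp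
    _ ≤ _ := by
        gcongr
        exact le_mul_of_one_le_right hn'.le hr'

end Tail

/-! ### Best error, one block against the whole sample, and Cramer's rule. -/

section MainEstimates

variable {X : Type*} {m : ℕ}

theorem mixtureWeight_pos {φ : Fin m → X → ℝ} {h : X → ℝ} {α : ℝ} (hα0 : 0 ≤ α) (hα1 : α < 1)
    {x : X} (hh : 0 < h x) : 0 < mixtureWeight φ h α x :=
  add_pos_of_nonneg_of_pos (mul_nonneg hα0 (christoffelWeight_nonneg φ x))
    (mul_pos (by linarith) hh)

theorem inv_mixtureWeight_mul_le {φ : Fin m → X → ℝ} {h : X → ℝ} {α : ℝ} (hα0 : 0 ≤ α)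
    (hα1 : α < 1) {x : X} (hh : 0 < h x) {s E : ℝ} (hs : s ≤ h x * E) (hE : 0 ≤ E) :
    (mixtureWeight φ h α x)⁻¹ * s ≤ (1 - α)⁻¹ * E := by
  have h1 : 0 < 1 - α := by linarith
  rw [inv_mul_le_iff₀ (mixtureWeight_pos hα0 hα1 hh)]
  have h2 : (1 - α) * h x ≤ mixtureWeight φ h α x :=
    le_add_of_nonneg_left (mul_nonneg hα0 (christoffelWeight_nonneg φ x))
  calc s ≤ h x * E := hs
    _ = ((1 - α) * h x) * ((1 - α)⁻¹ * E) := by field_simp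
    _ ≤ _ := by gcongr

/-- The empirical norm of `p - g` for a least-squares projection `p` of `f`. -/
theorem IsLeastSquares.sum_dotProduct_sq_le {ι : Type*} [Fintype ι] [Nonempty ι]
    {φ : Fin m → X → ℝ} {h : X → ℝ} {α : ℝ} (hα0 : 0 ≤ α) (hα1 : α < 1) (hh : ∀ x, 0 < h x)
    {f : X → ℝ} {x : ι → X} {c b : Fin m → ℝ} {E : ℝ} (hE : 0 ≤ E)
    (hls : IsLeastSquares φ (mixtureWeight φ h α) f x (combination φ c))
    (hb : ∀ i, (f (x i) - combination φ b (x i)) ^ 2 ≤ h (x i) * E) :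
    ∑ i, (weightedFeature φ (mixtureWeight φ h α) (x i) ⬝ᵥ (c - b)) ^ 2
      ≤ Fintype.card ι * ((1 - α)⁻¹ * E) := by
  have hw : ∀ x, 0 < mixtureWeight φ h α x := fun x => mixtureWeight_pos hα0 hα1 (hh x)
  have e : combination φ c - combination φ b = combination φ (c - b) := by
    ext y; simp [combination, sub_mul]
  have h1 := hls.sum_sq_le (fun i => hw (x i)) (mem_approxSpace_iff.2 ⟨b, rfl⟩)
  simp only [weightedFeature_dotProduct_sq (hw _)]
  rw [e] at h1
  refine h1.trans ?_
  rw [← nsmul_eq_mul, ← Finset.card_univ]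
  exact Finset.sum_le_card_nsmul _ _ _ fun i _ =>
    inv_mixtureWeight_mul_le hα0 hα1 (hh (x i)) (hb i) hE

theorem Embeds.ae_sq_le [MeasurableSpace X] {μ : Measure X} {h : X → ℝ} (hh : ∀ x, 0 < h x)
    {H : Submodule ℝ (X → ℝ)} {N : Seminorm ℝ H} {C : ℝ} (hH : Embeds μ h H N C) (u : H) :
    ∀ᵐ y ∂μ, (u : X → ℝ) y ^ 2 ≤ h y * N u ^ 2 := by
  have h1 := hH.linfty_le u
  rw [eLpNorm_exponent_top] at h1
  filter_upwards [ae_le_eLpNormEssSup (μ := μ) (f := fun x => (√(h x))⁻¹ * |(u : X → ℝ) x|)]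
    with y hy
  have h2 := hy.trans h1
  have h3 : 0 ≤ (√(h y))⁻¹ * |(u : X → ℝ) y| := by positivity
  rw [Real.enorm_eq_ofReal h3, ENNReal.ofReal_le_ofReal_iff (apply_nonneg N u)] at h2
  have h4 := pow_le_pow_left₀ h3 h2 2
  rw [mul_pow, sq_abs, inv_pow, Real.sq_sqrt (hh y).le, inv_mul_le_iff₀ (hh y)] at h4
  exact h4

/-- The infimum need not be attained. A minimizing sequence suffices, and being countable it
involves only one exceptional null set. -/
theorem bestError_spec {φ : Fin m → X → ℝ} {H : Submodule ℝ (X → ℝ)} {N : Seminorm ℝ H}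
    {f : X → ℝ} (hf : f ∈ H) : ∃ (b : ℕ → Fin m → ℝ) (hb : ∀ k, f - combination φ (b k) ∈ H),
      Tendsto (fun k => N ⟨f - combination φ (b k), hb k⟩) atTop (𝓝 (bestError φ H N f)) := by
  have hne : {t : ℝ | ∃ g ∈ approxSpace φ, ∃ hg : f - g ∈ H, t = N ⟨f - g, hg⟩}.Nonempty :=
    ⟨_, 0, Submodule.zero_mem _, by simpa using hf, rfl⟩
  have hbdd : BddBelow {t : ℝ | ∃ g ∈ approxSpace φ, ∃ hg : f - g ∈ H, t = N ⟨f - g, hg⟩} := by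
    refine ⟨0, ?_⟩
    rintro t ⟨g, -, hg, rfl⟩
    exact apply_nonneg N _
  obtain ⟨u, -, hu, hmem⟩ := exists_seq_tendsto_sInf hne hbdd
  have hrep : ∀ k, ∃ b : Fin m → ℝ, ∃ hb : f - combination φ b ∈ H,
      u k = N ⟨f - combination φ b, hb⟩ := fun k => by
    obtain ⟨g, hgV, hg, hk⟩ := hmem k
    obtain ⟨b, rfl⟩ := mem_approxSpace_iff.1 hgV
    exact ⟨b, hg, hk⟩
  choose b hb hbu using hrep
  refine ⟨b, hb, ?_⟩
  simp only [← hbu]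
  exact hu

/-- The Gram matrix of a family of points is invertible if that of a subfamily is. -/
theorem det_sumOuter_ne_zero {r n : ℕ} (v : X → Fin m → ℝ) (x : Fin r → Fin n → X) (k : Fin r)
    (hk : 0 < gramDet v (x k)) :
    (sumOuter v Finset.univ (Function.uncurry x)).det ≠ 0 := by
  intro h0
  obtain ⟨a, ha, hav⟩ := Matrix.exists_mulVec_eq_zero_iff.2 h0
  have h1 := dotProduct_sumOuter v Finset.univ (Function.uncurry x) a
  rw [hav, dotProduct_zero, Fintype.sum_prod_type] at h1
  have h2 : ∑ i, (v (x k i) ⬝ᵥ a) ^ 2 ≤ 0 := by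
    rw [h1]
    exact Finset.single_le_sum (f := fun k => ∑ i, (v (x k i) ⬝ᵥ a) ^ 2)
      (fun k _ => Finset.sum_nonneg fun i _ => sq_nonneg _) (Finset.mem_univ k)
  -- The right side is 0 times a finite number, so t = 1 and θ = 0 serve as well as any.
  have h3 := dotProduct_self_le_sampleBound v one_pos le_rfl hk a h2
  rw [zero_mul] at h3
  exact ha (dotProduct_self_eq_zero.1
    (le_antisymm h3 (Finset.sum_nonneg fun i _ => mul_self_nonneg _)))

theorem sum_block_le {r n : ℕ} (v : X → Fin m → ℝ) (x : Fin r → Fin n → X) (k : Fin r)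
    (a : Fin m → ℝ) : ∑ i, (v (x k i) ⬝ᵥ a) ^ 2
      ≤ ∑ p, (v (Function.uncurry x p) ⬝ᵥ a) ^ 2 := by
  rw [Fintype.sum_prod_type]
  exact Finset.single_le_sum (f := fun k => ∑ i, (v (x k i) ⬝ᵥ a) ^ 2)
      (fun k _ => Finset.sum_nonneg fun i _ => sq_nonneg _) (Finset.mem_univ k)

/-- Cramer's rule. The function f' will be a measurable version of f, so that the formula is
measurable in the sample. -/
theorem IsLeastSquares.coefficients_eq {ι : Type*} [Fintype ι] [Nonempty ι] {φ : Fin m → X → ℝ}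
    {w f f' : X → ℝ} {x : ι → X} {c : Fin m → ℝ} (h : IsLeastSquares φ w f x (combination φ c))
    (hw : ∀ i, 0 < w (x i)) (hf : ∀ i, f (x i) = f' (x i))
    (hdet : (sumOuter (weightedFeature φ w) Finset.univ x).det ≠ 0) (j : Fin m) :
    c j = (sumOuter (weightedFeature φ w) Finset.univ x).det⁻¹ *
      ∑ k, (sumOuter (weightedFeature φ w) Finset.univ x).adjugate j k *
        ∑ i, (w (x i))⁻¹ * (f' (x i) * φ k (x i)) := by
  have h1 := h.sumOuter_mulVec hw
  simp only [hf] at h1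
  set S := sumOuter (weightedFeature φ w) Finset.univ x
  have h2 := congrArg (fun u => (S.adjugate *ᵥ u) j) h1
  simp only [Matrix.mulVec_mulVec, Matrix.adjugate_mul, Matrix.smul_mulVec, Matrix.one_mulVec,
    Pi.smul_apply, smul_eq_mul] at h2
  rw [eq_inv_mul_iff_mul_eq₀ hdet, h2]
  rfl

end MainEstimates

end WLS

/-! ### Assembly of both parts. -/

theorem mainTheorem9 {X : Type*} [TopologicalSpace X] [PolishSpace X] [MeasurableSpace X]
    [BorelSpace X] (μ : Measure X) [IsProbabilityMeasure μ]
    (m : ℕ) (hm : 1 ≤ m) (φ : Fin m → X → ℝ) (hφ : WLS.IsONSystem μ φ)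
    (h : X → ℝ) (hh : WLS.IsPosDensity μ h)
    (H : Submodule ℝ (X → ℝ)) (N : Seminorm ℝ H) (C : ℝ) (hC : 0 ≤ C)
    (hH : WLS.Embeds μ h H N C)
    (f : X → ℝ) (hf : f ∈ H)
    (α : ℝ) (hα0 : 0 ≤ α) (hα1 : α < 1)
    (w : X → ℝ) (hw : w = WLS.mixtureWeight φ h α)
    (r nbar : ℕ) (hr : 1 ≤ r) (hnbar : m ≤ nbar)
    (fhat : (Fin r → Fin nbar → X) → X → ℝ)
    (hfhat : ∀ x, WLS.IsLeastSquares φ w f (Function.uncurry x) (fhat x))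
    (δ : ℝ) (hδ0 : 0 < δ) (hδ1 : δ < 1) :
    (WLS.repeatedVolumeSampling μ φ w nbar r)
        {x | 1 - δ ≤ WLS.lambdaMin (WLS.gram φ w (Function.uncurry x))}
      ≤ (WLS.repeatedVolumeSampling μ φ w nbar r)
        {x | WLS.l2norm μ (f - fhat x) ≤
          (C + (1 - δ) ^ (-(1 / 2) : ℝ) * (1 - α) ^ (-(1 / 2) : ℝ)) * WLS.bestError φ H N f} ∧
    (0 < α → m < nbar →
      (m : ℝ) + (WLS.cδ δ)⁻¹ * α⁻¹ * m * Real.log (((nbar * r : ℕ) : ℝ) * (m : ℝ) ^ 2)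
        ≤ (nbar : ℝ) →
      Integrable (fun x => WLS.l2norm μ (f - fhat x) ^ 2)
          (WLS.repeatedVolumeSampling μ φ w nbar r) ∧
        ∫ x, WLS.l2norm μ (f - fhat x) ^ 2 ∂(WLS.repeatedVolumeSampling μ φ w nbar r) ≤
          (2 * C ^ 2 + 2 * (1 - α)⁻¹ * r *
              (1 + (1 - (m : ℝ) / (nbar : ℝ))⁻¹ * (1 - δ)⁻¹)) *
            WLS.bestError φ H N f ^ 2) := by
  open WLS Matrix Filter Topology in
  subst hw
  have hw0 : ∀ x, 0 < mixtureWeight φ h α x := fun x => mixtureWeight_pos hα0 hα1 (hh.pos x)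
  have hwm := measurable_mixtureWeight hφ.measurable hh.measurable α
  have : NeZero m := ⟨by omega⟩
  have : Nonempty (Fin r × Fin nbar) := ⟨(⟨0, hr⟩, ⟨0, hm.trans hnbar⟩)⟩
  have hν := isProbabilityMeasure_weightedMeasure hm hφ hh hα0 hα1
  have hv := isIsotropic_weightedFeature hφ hwm hw0
  have hγ : IsProbabilityMeasure (volumeSampling μ φ (mixtureWeight φ h α) nbar) :=
    isProbabilityMeasure_gramSampling hv hnbar
  have hρ : IsProbabilityMeasure (repeatedVolumeSampling μ φ (mixtureWeight φ h α) nbar r) := by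
    unfold repeatedVolumeSampling; infer_instance
  have hc : ∀ x, ∃ c, fhat x = combination φ c := fun x => mem_approxSpace_iff.1 (hfhat x).1
  choose c hcf using hc
  have hls : ∀ x, IsLeastSquares φ (mixtureWeight φ h α) f (Function.uncurry x)
      (combination φ (c x)) := fun x => hcf x ▸ hfhat x
  obtain rfl : fhat = fun x => combination φ (c x) := funext hcf
  have h1α : 0 < 1 - α := by linarith
  have h1δ : 0 < 1 - δ := by linarith
  obtain ⟨b, hb, hlim⟩ := bestError_spec (φ := φ) (N := N) hf
  set Er : ℕ → ℝ := fun k => N ⟨f - combination φ (b k), hb k⟩ with hEr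
  have hEr0 : ∀ k, 0 ≤ Er k := fun k => apply_nonneg N _
  have hl2 : ∀ k, l2norm μ (f - combination φ (b k)) ≤ C * Er k := fun k => hH.l2_le ⟨_, hb k⟩
  have hsum : ∀ᵐ x ∂(repeatedVolumeSampling μ φ (mixtureWeight φ h α) nbar r), ∀ k,
      ∑ p, (weightedFeature φ (mixtureWeight φ h α) (Function.uncurry x p) ⬝ᵥ (c x - b k)) ^ 2
        ≤ (r * nbar : ℝ) * ((1 - α)⁻¹ * Er k ^ 2) := by
    refine ae_all_iff.2 fun k => ?_
    filter_upwards [ae_repeatedVolumeSampling (φ := φ) (w := mixtureWeight φ h α) (n := nbar)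
      (r := r) (hH.ae_sq_le hh.pos ⟨_, hb k⟩)] with x hx
    have := (hls x).sum_dotProduct_sq_le hα0 hα1 hh.pos (sq_nonneg (Er k)) fun p => hx p.1 p.2
    simpa using this
  have htri : ∀ x k, l2norm μ (f - combination φ (c x))
      ≤ C * Er k + √((c x - b k) ⬝ᵥ (c x - b k)) := fun x k => by
    have e : combination φ (c x) - combination φ (b k) = combination φ (c x - b k) := by
      ext y; simp [combination, sub_mul]
    have h1 := l2norm_sub_le (hH.memLp ⟨_, hb k⟩)
      (e ▸ memLp_combination hφ (c x - b k) : MemLp (combination φ (c x) - combination φ (b k)) 2 μ)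
    rw [e] at h1
    rw [← l2norm_combination_sq hφ, Real.sqrt_sq (l2norm_nonneg _ _)]
    exact h1.trans (by gcongr; exact hl2 k)
  refine ⟨?_, fun hα hmn hcond => ?_⟩
  -- The inclusion of events holds only up to a null set, since the weighted sup bound on f - g
  -- holds almost everywhere.
  · refine measure_mono_ae ?_
    filter_upwards [hsum] with x hx hS
    change 1 - δ ≤ lambdaMin _ at hS
    change l2norm μ (f - combination φ (c x)) ≤ _
    refine ge_of_tendsto' (hlim.const_mul _) fun k => (htri x k).trans ?_
    rw [add_mul]
    gcongr
    have h2 := mul_dotProduct_self_le_of_le_lambdaMin (gram_transpose _ _ _) hS (c x - b k)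
    have h3 := card_mul_dotProduct_gram (φ := φ) (x := Function.uncurry x)
      (fun p => hw0 _) (c x - b k)
    have hcard : (0 : ℝ) < r * nbar := by
      have : 0 < nbar := hm.trans hnbar
      positivity
    rw [Fintype.card_prod, Fintype.card_fin, Fintype.card_fin, Nat.cast_mul] at h3
    have h4 := le_of_mul_le_mul_left (h3.le.trans (hx k)) hcard
    have h5 : (c x - b k) ⬝ᵥ (c x - b k) ≤ (1 - δ)⁻¹ * ((1 - α)⁻¹ * Er k ^ 2) := by
      rw [← div_eq_inv_mul, le_div_iff₀ h1δ]
      linarith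
    refine (Real.sqrt_le_sqrt h5).trans (le_of_eq ?_)
    rw [Real.sqrt_mul (by positivity), Real.sqrt_mul (by positivity), Real.sqrt_sq (hEr0 k),
      Real.sqrt_eq_rpow, Real.sqrt_eq_rpow, ← Real.rpow_neg_one, ← Real.rpow_neg_one,
      ← Real.rpow_mul h1δ.le, ← Real.rpow_mul h1α.le]
    norm_num [mul_assoc]
  · set K : ℝ := m / α with hK
    set θ : ℝ := -Real.log (1 - δ) / K with hθ
    set t : ℝ := (1 - δ) * (nbar - m) with ht
    have hmn' : (0 : ℝ) < nbar - m := by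
      rw [sub_pos]; exact_mod_cast hmn
    have hn0 : (0 : ℝ) < nbar := by
      have : 0 < nbar := hm.trans hnbar
      positivity
    have ht0 : 0 < t := by positivity
    have hθ0 : 0 ≤ θ :=
      div_nonneg (neg_nonneg.2 (Real.log_nonpos h1δ.le (by linarith))) (by positivity)
    have hKv : ∀ x, weightedFeature φ (mixtureWeight φ h α) x ⬝ᵥ
        weightedFeature φ (mixtureWeight φ h α) x ≤ K := fun x =>
      weightedFeature_dotProduct_self_le hm hα (hw0 x)
        (le_add_of_nonneg_right (mul_nonneg h1α.le (hh.pos x).le))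
    -- The block used for the inverse bound; any block would do.
    let k₀ : Fin r := ⟨0, hr⟩
    have hpos : ∀ᵐ x ∂(repeatedVolumeSampling μ φ (mixtureWeight φ h α) nbar r),
        0 < gramDet (weightedFeature φ (mixtureWeight φ h α)) (x k₀) :=
      (Measure.quasiMeasurePreserving_eval
        (μ := fun _ : Fin r => volumeSampling μ φ (mixtureWeight φ h α) nbar) k₀).ae
        (ae_gramDet_pos hv.measurable nbar)
    have hfL : MemLp f 2 μ := hH.memLp ⟨f, hf⟩
    have hmeas : AEStronglyMeasurable (fun x => l2norm μ (f - combination φ (c x)) ^ 2)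
        (repeatedVolumeSampling μ φ (mixtureWeight φ h α) nbar r) := by
      -- The selection of minimizers is arbitrary, but the Gram matrix is almost surely invertible,
      -- so the coefficients agree almost surely with a measurable Cramer formula in a measurable
      -- version of f.
      have hfm := hfL.aestronglyMeasurable
      have hf' : Measurable (hfm.mk f) := hfm.stronglyMeasurable_mk.measurable
      let S := fun x : Fin r → Fin nbar → X =>
        sumOuter (weightedFeature φ (mixtureWeight φ h α)) Finset.univ (Function.uncurry x)
      have hunc : Measurable fun x : Fin r → Fin nbar → X => Function.uncurry x := by
        refine measurable_pi_lambda _ fun p => ?_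
        simp only [Function.uncurry]
        fun_prop
      have hSm : ∀ j k, Measurable fun x => S x j k := fun j k =>
        (measurable_sumOuter_apply hv.measurable Finset.univ j k).comp hunc
      let c' : (Fin r → Fin nbar → X) → Fin m → ℝ := fun x j => (S x).det⁻¹ *
        ∑ k, (S x).adjugate j k * ∑ p, (mixtureWeight φ h α (Function.uncurry x p))⁻¹ *
          (hfm.mk f (Function.uncurry x p) * φ k (Function.uncurry x p))
      have hc'm : ∀ j, Measurable fun x => c' x j := fun j => by
        refine (measurable_det hSm).inv.mul (Finset.measurable_fun_sum _ fun k _ =>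
          (measurable_adjugate hSm j k).mul (Finset.measurable_fun_sum _ fun p _ => ?_))
        have hp : Measurable fun x : Fin r → Fin nbar → X => Function.uncurry x p :=
          (measurable_pi_apply p).comp hunc
        exact (hwm.comp hp).inv.mul ((hf'.comp hp).mul ((hφ.measurable k).comp hp))
      have hae : (fun x => l2norm μ (f - combination φ (c x)) ^ 2)
          =ᵐ[repeatedVolumeSampling μ φ (mixtureWeight φ h α) nbar r] fun x =>
            ∫ y, f y ^ 2 ∂μ - 2 * ∑ j, c' x j * ∫ y, f y * φ j y ∂μ + c' x ⬝ᵥ c' x := by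
        filter_upwards [hpos, ae_repeatedVolumeSampling (φ := φ) (w := mixtureWeight φ h α)
          (n := nbar) (r := r) hfm.ae_eq_mk] with x hx1 hx2
        have hcx : c x = c' x := funext fun j => (hls x).coefficients_eq (fun p => hw0 _)
          (fun p => hx2 p.1 p.2) (det_sumOuter_ne_zero _ x k₀ hx1) j
        rw [integral_sub_combination_sq hφ hfL, hcx]
      refine AEStronglyMeasurable.congr (Measurable.aestronglyMeasurable ?_) hae.symm
      refine (measurable_const.sub ((Finset.measurable_fun_sum _ fun j _ =>
        (hc'm j).mul_const _).const_mul 2)).add ?_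
      exact Finset.measurable_fun_sum _ fun j _ => (hc'm j).mul (hc'm j)
    have hbound : ∀ k, ∫⁻ x, ENNReal.ofReal (l2norm μ (f - combination φ (c x)) ^ 2)
        ∂(repeatedVolumeSampling μ φ (mixtureWeight φ h α) nbar r)
        ≤ ENNReal.ofReal ((2 * C ^ 2 + 2 * (1 - α)⁻¹ * r *
              (1 + (1 - (m : ℝ) / (nbar : ℝ))⁻¹ * (1 - δ)⁻¹)) * Er k ^ 2) := fun k => by
      set M : ℝ := (r * nbar : ℝ) * ((1 - α)⁻¹ * Er k ^ 2) with hM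
      have hM0 : 0 ≤ M := by positivity
      have hF := lintegral_sampleBound_le hv hKv hnbar ht0 θ
      have htail := chernoff_tail_le hm hmn hr hδ0 hδ1 hα hcond
      have hmp := measurePreserving_eval
        (fun _ : Fin r => volumeSampling μ φ (mixtureWeight φ h α) nbar) k₀
      have hsbm := measurable_sampleBound (n := nbar) hv.measurable t θ
      calc _ ≤ ∫⁻ x, (ENNReal.ofReal (2 * C ^ 2 * Er k ^ 2) + ENNReal.ofReal (2 * M) *
            ENNReal.ofReal (sampleBound (weightedFeature φ (mixtureWeight φ h α)) t θ (x k₀)))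
            ∂(repeatedVolumeSampling μ φ (mixtureWeight φ h α) nbar r) := by
            refine lintegral_mono_ae ?_
            filter_upwards [hpos, hsum] with x hx1 hx2
            have hsb := sampleBound_nonneg (weightedFeature φ (mixtureWeight φ h α)) ht0.le θ (x k₀)
            rw [← ENNReal.ofReal_mul (by positivity),
              ← ENNReal.ofReal_add (by positivity) (by positivity)]
            refine ENNReal.ofReal_le_ofReal ?_
            have h1 := dotProduct_self_le_sampleBound _ ht0 hθ0 hx1 (c x - b k)
              ((sum_block_le _ x k₀ _).trans (hx2 k))
            have hd0 : 0 ≤ (c x - b k) ⬝ᵥ (c x - b k) :=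
              Finset.sum_nonneg fun i _ => mul_self_nonneg _
            have h2 := pow_le_pow_left₀ (l2norm_nonneg _ _) (htri x k) 2
            have h3 := Real.sq_sqrt hd0
            -- This gives (p+q)² ≤ 2p² + 2q², the source of the factors 2 in the constant.
            have h4 := sq_nonneg (C * Er k - √((c x - b k) ⬝ᵥ (c x - b k)))
            linarith [h1, h2, h3, h4]
        _ = ENNReal.ofReal (2 * C ^ 2 * Er k ^ 2) + ENNReal.ofReal (2 * M) *
            ∫⁻ y, ENNReal.ofReal (sampleBound (weightedFeature φ (mixtureWeight φ h α)) t θ y)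
              ∂(volumeSampling μ φ (mixtureWeight φ h α) nbar) := by
            rw [lintegral_add_left measurable_const, lintegral_const, measure_univ, mul_one,
              lintegral_const_mul' _ _ ENNReal.ofReal_ne_top]
            congr 2
            exact hmp.lintegral_comp hsbm.ennreal_ofReal
        _ ≤ ENNReal.ofReal (2 * C ^ 2 * Er k ^ 2) + ENNReal.ofReal (2 * M) *
            ENNReal.ofReal (t⁻¹ + (nbar : ℝ)⁻¹) := by
            gcongr
            refine hF.trans (ENNReal.ofReal_le_ofReal ?_)
            gcongr
        _ = _ := by
            rw [← ENNReal.ofReal_mul (by positivity),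
              ← ENNReal.ofReal_add (by positivity) (by positivity)]
            congr 1
            -- With the factor r n̄ of M, the term 1/t becomes r (1 - m/n̄)⁻¹(1-δ)⁻¹ and 1/n̄
            -- becomes r.
            have e : 1 - (m : ℝ) / nbar = (nbar - m) / nbar := by field_simp
            rw [hM, ht, e]
            field_simp
            ring
    have hnn : ∀ x, 0 ≤ l2norm μ (f - combination φ (c x)) ^ 2 := fun x => sq_nonneg _
    have hB0 : 0 ≤ 2 * C ^ 2 + 2 * (1 - α)⁻¹ * r *
        (1 + (1 - (m : ℝ) / (nbar : ℝ))⁻¹ * (1 - δ)⁻¹) := by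
      have e : 1 - (m : ℝ) / nbar = (nbar - m) / nbar := by field_simp
      rw [e]
      positivity
    refine ⟨⟨hmeas, ?_⟩, ?_⟩
    · rw [hasFiniteIntegral_iff_ofReal (Eventually.of_forall hnn)]
      exact (hbound 0).trans_lt ENNReal.ofReal_lt_top
    · refine ge_of_tendsto' ((hlim.pow 2).const_mul _) fun k => ?_
      rw [integral_eq_lintegral_of_nonneg_ae (Eventually.of_forall hnn) hmeas]
      exact ENNReal.toReal_le_of_le_ofReal (by positivity) (hbound k)
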